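/- Let $a,b>0$ be real numbers with $ab$ rational and let $g\in L^2(\mathbb R)$ (complex-valued). For $m,n\in\mathbb Z$ put $g_{m,n}(t)=e^{2\pi i m b t}g(t-na)$. Suppose that $(g,a,b)$ is a Weyl–Heisenberg frame, i.e. there are constants $0<A,B<\infty$ with $$A\|f\|^2\le\sum_{m,n\in\mathbb Z}|\langle f,g_{m,n}\rangle|^2\le B\|f\|^2\qquad\text{for all } f\in L^2(\mathbb R),$$ and let $S f=\sum_{m,n\in\mathbb Z}\langle f,g_{m,n}\rangle g_{m,n}$ be its frame operator, an invertible operator on $L^2(\mathbb R)$. For $h\in L^2(\mathbb R)$, say that $h$ (more precisely, $(h,a,b)$) satisfies the *uniform CC-condition* if the system $(e^{2\pi i m b t}h(t-na))_{m,n\in\mathbb Z}$ has a finite upper frame bound (the right-hand inequality above holds for it with some finite constant) and for every $\varepsilon>0$ there is an integer $K>0$ such that for almost every $t\in\mathbb R$ $$\sum_{k\in\mathbb Z,\ |k|\ge K}\Big|\sum_{n\in\mathbb Z}h(t-na)\,\overline{h(t-na-k/b)}\Big|<\varepsilon .$$ If $g$ satisfies the uniform CC-condition, then its canonical dual window $S^{-1}g$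 also satisfies the uniform CC-condition. -/

import Mathlib

open MeasureTheory

noncomputable section

namespace WeylHeisenberg

/-! ### Frames and the frame operator in a complex Hilbert space -/

section Frames

variable {ι H : Type*} [NormedAddCommGroup H] [InnerProductSpace ℂ H]

/-- The family `φ` has a finite upper frame bound: there is `B > 0` with
`∑ |⟨f, φ i⟩|² ≤ B ‖f‖²` (in particular the sum converges) for all `f`.
Mathlib's inner product is linear in the second slot, so `⟨f, φ i⟩` is `inner ℂ (φ i) f`. -/
def HasUpperFrameBound (φ : ι → H) : Prop :=
  ∃ B : ℝ, 0 < B ∧ ∀ f : H, Summable (fun i => ‖inner ℂ (φ i) f‖ ^ 2) ∧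
    ∑' i, ‖inner ℂ (φ i) f‖ ^ 2 ≤ B * ‖f‖ ^ 2

/-- The family `φ` is a frame: `A ‖f‖² ≤ ∑ |⟨f, φ i⟩|² ≤ B ‖f‖²` for all `f`, with constants
`A > 0` and `B < ∞`. -/
def IsFrame (φ : ι → H) : Prop :=
  ∃ A B : ℝ, 0 < A ∧ 0 < B ∧ ∀ f : H, Summable (fun i => ‖inner ℂ (φ i) f‖ ^ 2) ∧
    A * ‖f‖ ^ 2 ≤ ∑' i, ‖inner ℂ (φ i) f‖ ^ 2 ∧
    ∑' i, ‖inner ℂ (φ i) f‖ ^ 2 ≤ B * ‖f‖ ^ 2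

/-- The frame operator `S f = ∑ ⟨f, φ i⟩ φ i` (unconditional norm convergence in `H`, which
holds whenever there is a finite upper frame bound, see `hasSum_frameOperator`). -/
def frameOperator (φ : ι → H) (f : H) : H :=
  ∑' i, inner ℂ (φ i) f • φ i

theorem IsFrame.hasUpperFrameBound {φ : ι → H} (h : IsFrame φ) : HasUpperFrameBound φ := by
  obtain ⟨A, B, _, hB, h⟩ := h
  exact ⟨B, hB, fun f => ⟨(h f).1, (h f).2.2⟩⟩

variable [CompleteSpace H]

/-- A family with a finite upper frame bound has a bounded frame operator, given by
unconditionally convergent series. -/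
theorem HasUpperFrameBound.exists_clm {φ : ι → H} (h : HasUpperFrameBound φ) :
    ∃ S : H →L[ℂ] H, ∀ f, HasSum (fun i => inner ℂ (φ i) f • φ i) (S f) := by
  classical
  obtain ⟨B, hB, h⟩ := h
  have h2 : (0 : ℝ) < (2 : ENNReal).toReal := by norm_num
  have hmem : ∀ f : H, Memℓp (E := fun _ : ι => ℂ) (fun i => inner ℂ (φ i) f) 2 := fun f =>
    memℓp_gen (by simpa using (h f).1)
  let C₀ : H →ₗ[ℂ] lp (fun _ : ι => ℂ) 2 :=
    { toFun := fun f => ⟨fun i => inner ℂ (φ i) f, hmem f⟩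
      map_add' := fun f g => by
        ext i
        exact inner_add_right _ _ _
      map_smul' := fun c f => by
        ext i
        exact inner_smul_right _ _ _ }
  have hC₀ : ∀ f i, C₀ f i = inner ℂ (φ i) f := fun f i => rfl
  have hbound : ∀ f, ‖C₀ f‖ ≤ Real.sqrt B * ‖f‖ := by
    intro f
    have h1 := lp.norm_rpow_eq_tsum h2 (C₀ f)
    simp only [hC₀, ENNReal.toReal_ofNat, Real.rpow_ofNat] at h1
    refine (sq_le_sq₀ (norm_nonneg _) (by positivity)).1 ?_
    rw [h1, mul_pow, Real.sq_sqrt hB.le]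
    exact (h f).2
  let C : H →L[ℂ] lp (fun _ : ι => ℂ) 2 := C₀.mkContinuous _ hbound
  refine ⟨(ContinuousLinearMap.adjoint C).comp C, fun f => ?_⟩
  have hs := (lp.hasSum_single (E := fun _ : ι => ℂ) (p := 2) (by norm_num) (C f)).mapL
    (ContinuousLinearMap.adjoint C)
  have he : ∀ i, ContinuousLinearMap.adjoint C (lp.single 2 i (C f i)) =
      (inner ℂ (φ i) f : ℂ) • φ i := by
    intro i
    refine ext_inner_right ℂ fun v => ?_
    rw [ContinuousLinearMap.adjoint_inner_left, lp.inner_single_left]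
    change inner ℂ (inner ℂ (φ i) f) (inner ℂ (φ i) v) = _
    rw [inner_smul_left, RCLike.inner_apply, mul_comm]
  simp only [he] at hs
  exact hs

theorem HasUpperFrameBound.hasSum_frameOperator {φ : ι → H} (h : HasUpperFrameBound φ) (f : H) :
    HasSum (fun i => inner ℂ (φ i) f • φ i) (frameOperator φ f) := by
  obtain ⟨S, hS⟩ := h.exists_clm
  exact (hS f).summable.hasSum

/-- The frame operator of a frame is invertible. -/
theorem IsFrame.bijective_frameOperator {φ : ι → H} (h : IsFrame φ) :
    Function.Bijective (frameOperator φ) := by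
  obtain ⟨S, hS⟩ := h.hasUpperFrameBound.exists_clm
  have hSe : frameOperator φ = S := funext fun f => (hS f).tsum_eq
  rw [hSe, ← ContinuousLinearMap.isUnit_iff_bijective]
  obtain ⟨A, B, hA, _, h⟩ := h
  refine S.isUnit_of_forall_le_norm_inner_map (c := ⟨A, hA.le⟩) hA fun f => ?_
  have h1 : HasSum (fun i => ((‖inner ℂ (φ i) f‖ ^ 2 : ℝ) : ℂ)) (inner ℂ f (S f)) := by
    have h3 := (hS f).mapL (innerSL ℂ f)
    have h4 : ∀ i, innerSL ℂ f (inner ℂ (φ i) f • φ i) = ((‖inner ℂ (φ i) f‖ ^ 2 : ℝ) : ℂ) := by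
      intro i
      rw [innerSL_apply_apply, inner_smul_right, ← inner_conj_symm f (φ i), RCLike.mul_conj]
      push_cast
      rfl
    simpa only [h4, innerSL_apply_apply] using h3
  have h2 : (inner ℂ f (S f) : ℂ) = ((∑' i, ‖inner ℂ (φ i) f‖ ^ 2 : ℝ) : ℂ) :=
    h1.unique (Complex.hasSum_ofReal.mpr (h f).1.hasSum)
  rw [norm_inner_symm, h2, Complex.norm_real, mul_comm]
  exact (h f).2.1.trans (le_abs_self _)

/-- The frame operator `S` of a frame, as a bijection of `H`; its inverse `S⁻¹` is `.symm`. -/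
def IsFrame.frameEquiv {φ : ι → H} (h : IsFrame φ) : H ≃ H :=
  Equiv.ofBijective (frameOperator φ) h.bijective_frameOperator

end Frames

/-! ### Weyl–Heisenberg systems -/

/-- The complex Hilbert space `L²(ℝ)`. -/
abbrev L2R : Type := Lp ℂ 2 (volume : Measure ℝ)

theorem memLp_translate_modulate (x ω : ℝ) (g : L2R) :
    MemLp (fun t : ℝ => Complex.exp (2 * Real.pi * Complex.I * ω * t) * g (t - x)) 2 volume := by
  have h := (Lp.memLp g).comp_measurePreserving (measurePreserving_sub_right volume x)
  refine h.of_le (AEStronglyMeasurable.mul ?_ h.1) (Filter.Eventually.of_forall fun t => ?_)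
  · exact Continuous.aestronglyMeasurable (by fun_prop)
  · have : (2 * Real.pi * Complex.I * ω * t : ℂ) = ((2 * Real.pi * ω * t : ℝ) : ℂ) * Complex.I := by
      push_cast
      ring
    rw [norm_mul, this, Complex.norm_exp_ofReal_mul_I, one_mul]
    rfl

/-- The time-frequency shift `E_ω T_x g (t) = e^{2πiωt} g(t - x)` of `g ∈ L²(ℝ)`. -/
def modTrans (ω x : ℝ) (g : L2R) : L2R :=
  (memLp_translate_modulate x ω g).toLp _

/-- The Weyl–Heisenberg system `(E_{mb} T_{na} g)_{m,n ∈ ℤ}`. -/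
def whSystem (g : L2R) (a b : ℝ) : ℤ × ℤ → L2R :=
  fun mn => modTrans (mn.1 * b) (mn.2 * a) g

/-- The functions `G_k(t) = ∑_n g(t - na) conj (g(t - na - k/b))`. For `g ∈ L²(ℝ)` and `a > 0`
the series converges absolutely for almost every `t`. -/
def corr (g : L2R) (a b : ℝ) (k : ℤ) (t : ℝ) : ℂ :=
  ∑' n : ℤ, g (t - n * a) * starRingEnd ℂ (g (t - n * a - k / b))

/-- The uniform CC-condition for `(g, a, b)`: the system has a finite upper frame bound, and for
every `ε > 0` there is `K > 0` such that `∑_{|k| ≥ K} |G_k(t)| < ε` for almost every `t`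
(the sum is taken in `[0, ∞]`, so the inequality includes convergence). -/
def UniformCC (g : L2R) (a b : ℝ) : Prop :=
  HasUpperFrameBound (whSystem g a b) ∧
    ∀ ε : ℝ, 0 < ε → ∃ K : ℕ, 0 < K ∧ ∀ᵐ t : ℝ,
      ∑' k : {k : ℤ // (K : ℤ) ≤ |k|}, ‖corr g a b k t‖ₑ < ENNReal.ofReal ε

end WeylHeisenberg

end

/-! Each modulation takes a single value on the fibre t + ℤ/b, so Parseval in m turns the frame
operator into a family of bi-infinite matrices: by Walnut's representation S acts on (f(t + l/b))_l
through the entries b⁻¹ G_{j-l}(t + j/b) (`fiberMatrix`, `frameOperator_ae`). The lower frame bound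
makes almost all of these matrices coercive with one constant (`ae_forall_le_form`). Since S
commutes with the time-frequency shifts, S⁻¹ is the frame operator of the system generated by S⁻¹g
(`whSystem_dual`, `IsFrame.frameOperator_dual`). Its fibre matrices carry the correlations of S⁻¹g,
and their columns F of index 0 solve M F = δ₀ (`ae_hasSum_fiberMatrix_dual`).

What remains is a Wiener lemma uniform in t (`exists_tail_enorm_le`). Rationality of ab enters here:
G_k has period a, so G_k(t + j/b) takes at most p values as j varies, and summing their moduli
dominates each matrix by a convolution kernel with uniformly small tails. To control F, cut it with
bumps of width L. Commutators of M with slowly varying bumps are small, so coercivity bounds each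
local norm of F by that of δ₀ plus a kernel of total mass at most 1/2 acting on the local norms
(`mul_locNorm_le`). Iteration gives a uniform ℓ¹ bound on the local norms
(`tsum_le_of_le_add_kernel`), and doubling the radius halves their tails up to a small error
(`tail_two_mul_le`). -/

open MeasureTheory

noncomputable section

namespace WeylHeisenberg

open scoped ENNReal

/-! ### Sequences dominated by a contractive kernel -/

section Kernel

/-- A Neumann series argument that does not presuppose summability of `x`. After N substitutions the
error is at most 2⁻ᴺ X at each index, by the row sums, while the column sums preserve the bound 2 ∑
y on the main term. On a finite set of indices the error tends to 0. -/
theorem tsum_le_of_le_add_kernel {ι : Type*} {x y : ι → ℝ≥0∞} {e : ι → ι → ℝ≥0∞} {X : ℝ≥0∞}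
    (hX : X ≠ ⊤) (hx : ∀ i, x i ≤ X) (hle : ∀ i, x i ≤ y i + ∑' i', e i i' * x i')
    (hrow : ∀ i, ∑' i', e i i' ≤ 2⁻¹) (hcol : ∀ i', ∑' i, e i i' ≤ 2⁻¹) :
    ∑' i, x i ≤ 2 * ∑' i, y i := by
  have key : ∀ N : ℕ, ∃ s : ι → ℝ≥0∞, ∑' i, s i ≤ 2 * ∑' i, y i ∧
      ∀ i, x i ≤ s i + 2⁻¹ ^ N * X := by
    intro N
    induction N with
    | zero => exact ⟨0, by simp, fun i => by simpa using hx i⟩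
    | succ N ih =>
      obtain ⟨s, hs, hxs⟩ := ih
      refine ⟨fun i => y i + ∑' i', e i i' * s i', ?_, fun i => ?_⟩
      · rw [ENNReal.tsum_add, ENNReal.tsum_comm, two_mul]
        refine add_le_add le_rfl ?_
        calc ∑' i', ∑' i, e i i' * s i' ≤ ∑' i', 2⁻¹ * s i' := by
              refine ENNReal.tsum_le_tsum fun i' => ?_
              rw [ENNReal.tsum_mul_right]
              gcongr
              exact hcol i'
          _ ≤ 2⁻¹ * (2 * ∑' i, y i) := by
              rw [ENNReal.tsum_mul_left]
              gcongr
          _ = ∑' i, y i := by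
              rw [← mul_assoc, ENNReal.inv_mul_cancel (by simp) (by simp), one_mul]
      · calc x i ≤ y i + ∑' i', e i i' * x i' := hle i
          _ ≤ y i + ∑' i', (e i i' * s i' + e i i' * (2⁻¹ ^ N * X)) := by
              gcongr with i'
              rw [← mul_add]
              gcongr
              exact hxs i'
          _ ≤ y i + ∑' i', e i i' * s i' + 2⁻¹ ^ (N + 1) * X := by
              rw [ENNReal.tsum_add, ENNReal.tsum_mul_right, ← add_assoc, pow_succ', mul_assoc]
              gcongr
              exact hrow i
  rw [ENNReal.tsum_eq_iSup_sum]
  refine iSup_le fun F => ?_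
  have hlim : Filter.Tendsto (fun N : ℕ => 2 * ∑' i, y i + 2⁻¹ ^ N * (F.card * X))
      Filter.atTop (nhds (2 * ∑' i, y i)) := by
    have h0 : Filter.Tendsto (fun N : ℕ => (2⁻¹ : ℝ≥0∞) ^ N) Filter.atTop (nhds 0) :=
      ENNReal.tendsto_pow_atTop_nhds_zero_of_lt_one (by simp)
    have h1 := ENNReal.Tendsto.mul_const h0
      (Or.inr (ENNReal.mul_ne_top (ENNReal.natCast_ne_top F.card) hX))
    simpa using h1.const_add (2 * ∑' i, y i)
  refine ge_of_tendsto' hlim fun N => ?_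
  obtain ⟨s, hs, hxs⟩ := key N
  calc ∑ i ∈ F, x i ≤ ∑ i ∈ F, (s i + 2⁻¹ ^ N * X) := Finset.sum_le_sum fun i _ => hxs i
    _ = ∑ i ∈ F, s i + 2⁻¹ ^ N * (F.card * X) := by
        rw [Finset.sum_add_distrib, Finset.sum_const, nsmul_eq_mul]
        ring
    _ ≤ 2 * ∑' i, y i + 2⁻¹ ^ N * (F.card * X) := by
        gcongr
        exact (ENNReal.sum_le_tsum F).trans hs

/-- The part of the sum of `a` over `|k| ≥ K`. -/
def tail (a : ℤ → ℝ≥0∞) (K : ℕ) : ℝ≥0∞ := ∑' k : ℤ, if (K : ℤ) ≤ |k| then a k else 0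

theorem tail_le_tsum (a : ℤ → ℝ≥0∞) (K : ℕ) : tail a K ≤ ∑' k, a k :=
  ENNReal.tsum_le_tsum fun k => by split_ifs <;> simp

theorem tail_anti (a : ℤ → ℝ≥0∞) : Antitone (tail a) := fun K K' h =>
  ENNReal.tsum_le_tsum fun k => by
    split_ifs with h1 h2
    · exact le_rfl
    · omega
    · simp
    · simp

/-- Split by the source index i'. If |i'| ≥ I, the column sum gives the factor 1/2; otherwise |i| ≥
2I forces |i - i'| ≥ I, and only the far part of the kernel contributes. -/
theorem tail_two_mul_le {x y : ℤ → ℝ≥0∞} {e : ℤ → ℤ → ℝ≥0∞} {I : ℕ} {σ : ℝ≥0∞} (hI : 1 ≤ I)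
    (hy : ∀ i, 2 ≤ |i| → y i = 0)
    (hle : ∀ i, x i ≤ y i + ∑' i', e i i' * x i') (hcol : ∀ i', ∑' i, e i i' ≤ 2⁻¹)
    (hσ : ∀ i', ∑' i, (if (I : ℤ) ≤ |i - i'| then e i i' else 0) ≤ σ) :
    tail x (2 * I) ≤ 2⁻¹ * tail x I + (∑' i, x i) * σ := by
  calc tail x (2 * I) ≤ ∑' i : ℤ, ∑' i' : ℤ, (if (2 * I : ℤ) ≤ |i| then e i i' * x i' else 0) := by
        refine ENNReal.tsum_le_tsum fun i => ?_
        push_cast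
        split_ifs with h
        · simpa [hy i (by omega)] using hle i
        · simp
    _ = ∑' i' : ℤ, (∑' i : ℤ, if (2 * I : ℤ) ≤ |i| then e i i' else 0) * x i' := by
        rw [ENNReal.tsum_comm]
        refine tsum_congr fun i' => ?_
        rw [← ENNReal.tsum_mul_right]
        refine tsum_congr fun i => ?_
        split_ifs <;> simp
    _ ≤ ∑' i' : ℤ, (2⁻¹ * (if (I : ℤ) ≤ |i'| then x i' else 0) + x i' * σ) := by
        refine ENNReal.tsum_le_tsum fun i' => ?_
        split_ifs with h
        · refine le_add_right ?_
          gcongr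
          refine le_trans (ENNReal.tsum_le_tsum fun i => ?_) (hcol i')
          split_ifs <;> simp
        · rw [mul_zero, zero_add, mul_comm]
          gcongr
          refine le_trans (ENNReal.tsum_le_tsum fun i => ?_) (hσ i')
          split_ifs with h1 h2
          · exact le_rfl
          · have := abs_sub_abs_le_abs_sub i i'
            omega
          · simp
          · simp
    _ = 2⁻¹ * tail x I + (∑' i, x i) * σ := by
        rw [ENNReal.tsum_add, ENNReal.tsum_mul_left, ENNReal.tsum_mul_right, tail]

/-- δ is the fixed point of τ ↦ τ/2 + δ/2, so the errors do not accumulate. -/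
theorem tail_two_pow_mul_le {x : ℤ → ℝ≥0∞} {I : ℕ} {D δ : ℝ≥0∞} (hD : ∑' i, x i ≤ D)
    (h : ∀ J, I ≤ J → tail x (2 * J) ≤ 2⁻¹ * tail x J + 2⁻¹ * δ) (n : ℕ) :
    tail x (2 ^ n * I) ≤ 2⁻¹ ^ n * D + δ := by
  induction n with
  | zero => simpa using le_add_right ((tail_le_tsum x I).trans hD)
  | succ n ih =>
    calc tail x (2 ^ (n + 1) * I) = tail x (2 * (2 ^ n * I)) := by ring_nf
      _ ≤ 2⁻¹ * tail x (2 ^ n * I) + 2⁻¹ * δ :=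
          h _ (Nat.le_mul_of_pos_left _ (by positivity))
      _ ≤ 2⁻¹ * (2⁻¹ ^ n * D + δ) + 2⁻¹ * δ := by gcongr
      _ = 2⁻¹ ^ (n + 1) * D + (2⁻¹ + 2⁻¹) * δ := by ring
      _ = 2⁻¹ ^ (n + 1) * D + δ := by rw [ENNReal.inv_two_add_inv_two, one_mul]

theorem tsum_mul_le_sqrt_mul_sqrt {ι : Type*} (u v : ι → ℝ≥0∞) :
    ∑' i, u i * v i ≤ (∑' i, u i ^ 2) ^ (1 / 2 : ℝ) * (∑' i, v i ^ 2) ^ (1 / 2 : ℝ) := by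
  let _ : MeasurableSpace ι := ⊤
  have h := ENNReal.lintegral_mul_le_Lp_mul_Lq (Measure.count : Measure ι)
    (p := 2) (q := 2) ⟨by norm_num, by norm_num, by norm_num⟩ (f := u) (g := v)
    measurable_from_top.aemeasurable measurable_from_top.aemeasurable
  simpa [lintegral_count] using h

end Kernel

/-! ### Localization of bi-infinite matrices -/

section Localization

/-- A bump function at scale `L` centred at `i * L`. -/
def bump (L : ℕ) (i j : ℤ) : ℝ := max 0 (min 1 (2 - |(j : ℝ) / L - i|))

theorem bump_nonneg (L : ℕ) (i j : ℤ) : 0 ≤ bump L i j := le_max_left _ _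

theorem bump_le_one (L : ℕ) (i j : ℤ) : bump L i j ≤ 1 :=
  max_le zero_le_one (min_le_left _ _)

theorem abs_sub_lt_of_bump_ne_zero {L : ℕ} (hL : 0 < L) {i j : ℤ} (h : bump L i j ≠ 0) :
    |j - i * L| < 2 * L := by
  have hL' : (0 : ℝ) < L := by exact_mod_cast hL
  have h1 : |(j : ℝ) / L - i| < 2 := by
    by_contra! h2
    exact h (max_eq_left ((min_le_right _ _).trans (by linarith)))
  have h2 : |(j : ℝ) - i * L| < 2 * L := by
    have : (j : ℝ) - i * L = ((j : ℝ) / L - i) * L := by field_simp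
    rw [this, abs_mul, abs_of_pos hL']
    gcongr
  exact_mod_cast h2

/-- Every integer lies on the plateau of some bump, so pointwise values can be recovered from local
norms. -/
theorem bump_ediv_eq_one {L : ℕ} (hL : 0 < L) (j : ℤ) : bump L (j / L) j = 1 := by
  have hL' : (0 : ℝ) < L := by exact_mod_cast hL
  have h0 : (j : ℝ) = (j / (L : ℤ) : ℤ) * L + (j % (L : ℤ) : ℤ) := by
    exact_mod_cast (by rw [mul_comm]; exact (Int.mul_ediv_add_emod j L).symm)
  have h1 : (0 : ℝ) ≤ (j % (L : ℤ) : ℤ) := by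
    exact_mod_cast Int.emod_nonneg j (by omega)
  have h2 : ((j % (L : ℤ) : ℤ) : ℝ) < L := by
    exact_mod_cast Int.emod_lt_of_pos j (by omega)
  have h3 : (j : ℝ) / L - (j / (L : ℤ) : ℤ) = (j % (L : ℤ) : ℤ) / (L : ℝ) := by
    conv_lhs => rw [h0]
    field_simp
    ring
  have h4 : |(j : ℝ) / L - (j / (L : ℤ) : ℤ)| ≤ 1 := by
    rw [h3, abs_of_nonneg (by positivity)]
    exact (div_le_one hL').2 h2.le
  unfold bump
  rw [min_eq_left (by linarith), max_eq_right zero_le_one]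

theorem abs_bump_sub_bump_le (L : ℕ) (i j l : ℤ) :
    |bump L i j - bump L i l| ≤ min 1 (|((j - l : ℤ) : ℝ)| / L) := by
  refine le_min ?_ ?_
  · rw [abs_le]
    constructor <;> linarith [bump_nonneg L i j, bump_le_one L i j, bump_nonneg L i l,
      bump_le_one L i l]
  · calc |bump L i j - bump L i l|
        ≤ |min 1 (2 - |(j : ℝ) / L - i|) - min 1 (2 - |(l : ℝ) / L - i|)| := by
          simpa [bump] using abs_max_sub_max_le_max 0 (min 1 (2 - |(j : ℝ) / L - i|)) 0
            (min 1 (2 - |(l : ℝ) / L - i|))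
      _ ≤ |(2 - |(j : ℝ) / L - i|) - (2 - |(l : ℝ) / L - i|)| := by
          simpa using abs_min_sub_min_le_max 1 (2 - |(j : ℝ) / L - i|) 1 (2 - |(l : ℝ) / L - i|)
      _ = |(|(l : ℝ) / L - i|) - (|(j : ℝ) / L - i|)| := by congr 1; ring
      _ ≤ |((l : ℝ) / L - i) - ((j : ℝ) / L - i)| := abs_abs_sub_abs_le_abs_sub _ _
      _ = |((j - l : ℤ) : ℝ)| / L := by
          rw [abs_sub_comm]
          push_cast
          rw [show (j : ℝ) / L - i - (l / L - i) = (j - l) / L by ring, abs_div, Nat.abs_cast]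

/-- The `ℓ²`-norm of `F` localized by the bump function `bump L i`. -/
def locNorm (L : ℕ) (F : ℤ → ℂ) (i : ℤ) : ℝ≥0∞ :=
  (∑' j, ‖(bump L i j : ℂ) * F j‖ₑ ^ 2) ^ (1 / 2 : ℝ)

/-- A kernel controlling commutators of a matrix dominated by `a` with the bump functions. -/
def commKernel (L : ℕ) (a : ℤ → ℝ≥0∞) (n : ℤ) : ℝ≥0∞ :=
  ∑' k : ℤ, a k * ENNReal.ofReal (min 1 (|(k : ℝ)| / L)) *
    (if |k - n * L| < 4 * (L : ℤ) then 1 else 0)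

theorem locNorm_sq (L : ℕ) (F : ℤ → ℂ) (i : ℤ) :
    locNorm L F i ^ 2 = ∑' j, ‖(bump L i j : ℂ) * F j‖ₑ ^ 2 := by
  rw [locNorm, ← ENNReal.rpow_natCast, ← ENNReal.rpow_mul]
  norm_num

theorem bump_eq_zero_of_notMem {L : ℕ} (hL : 0 < L) {i j : ℤ}
    (hj : j ∉ Finset.Icc (i * L - 2 * L) (i * L + 2 * L)) : bump L i j = 0 := by
  by_contra h
  have := abs_lt.1 (abs_sub_lt_of_bump_ne_zero hL h)
  exact hj (Finset.mem_Icc.2 ⟨by linarith, by linarith⟩)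

/-- A bump lives on at most 4L + 1 integers. The bound serves only as a priori finiteness: for
cancelling a local norm and for starting the Neumann iteration. -/
theorem locNorm_le {L : ℕ} (hL : 0 < L) {F : ℤ → ℂ} {C : ℝ≥0∞} (hF : ∀ j, ‖F j‖ₑ ≤ C) (i : ℤ) :
    locNorm L F i ≤ ((4 * L + 1 : ℕ) * C ^ 2) ^ (1 / 2 : ℝ) := by
  unfold locNorm
  gcongr
  rw [tsum_eq_sum (s := Finset.Icc (i * L - 2 * L) (i * L + 2 * L))
    fun j hj => by simp [bump_eq_zero_of_notMem hL hj]]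
  refine (Finset.sum_le_card_nsmul _ _ (C ^ 2) fun j _ => ?_).trans ?_
  · gcongr
    rw [enorm_mul]
    refine le_trans ?_ (hF j)
    refine mul_le_of_le_one_left (zero_le) ?_
    rw [← ofReal_norm, Complex.norm_real, Real.norm_of_nonneg (bump_nonneg _ _ _)]
    exact ENNReal.ofReal_le_one.2 (bump_le_one _ _ _)
  · rw [nsmul_eq_mul, Int.card_Icc]
    gcongr
    omega

theorem tsum_mul_shift_le (L : ℕ) (F : ℤ → ℂ) (i i' k : ℤ) :
    ∑' j : ℤ, ‖(bump L i j : ℂ) * F j‖ₑ * ‖(bump L i' (j - k) : ℂ) * F (j - k)‖ₑ ≤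
      locNorm L F i * locNorm L F i' := by
  refine (tsum_mul_le_sqrt_mul_sqrt _ _).trans_eq ?_
  congr 2
  exact (Equiv.subRight k).tsum_eq fun j => ‖(bump L i' j : ℂ) * F j‖ₑ ^ 2

/-- With b the bump as a multiplication operator, M(bF) = bR + [M, b]F, and the commutator has
entries M j l (b l - b j). -/
theorem enorm_sum_bump_le {M : ℤ → ℤ → ℂ} {F R : ℤ → ℂ} {L : ℕ} (hL : 0 < L)
    (hMF : ∀ j, HasSum (fun l => M j l * F l) (R j)) (i j : ℤ) :
    ‖∑ l ∈ Finset.Icc (i * L - 2 * L) (i * L + 2 * L), M j l * ((bump L i l : ℂ) * F l)‖ₑ ≤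
      ‖(bump L i j : ℂ) * R j‖ₑ +
        ∑' l, ‖M j l‖ₑ * ENNReal.ofReal |bump L i j - bump L i l| * ‖F l‖ₑ := by
  have h1 : HasSum (fun l => M j l * ((bump L i l : ℂ) * F l))
      (∑ l ∈ Finset.Icc (i * L - 2 * L) (i * L + 2 * L), M j l * ((bump L i l : ℂ) * F l)) :=
    hasSum_sum_of_ne_finset_zero fun l hl => by simp [bump_eq_zero_of_notMem hL hl]
  have h2 := h1.sub ((hMF j).mul_left (bump L i j : ℂ))
  rw [← sub_add_cancel (∑ l ∈ Finset.Icc (i * L - 2 * L) (i * L + 2 * L),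
    M j l * ((bump L i l : ℂ) * F l)) ((bump L i j : ℂ) * R j), add_comm]
  refine (enorm_add_le _ _).trans ?_
  gcongr
  rw [← h2.tsum_eq]
  refine (enorm_tsum_le_tsum_enorm).trans (ENNReal.tsum_le_tsum fun l => ?_)
  rw [show M j l * ((bump L i l : ℂ) * F l) - (bump L i j : ℂ) * (M j l * F l) =
    M j l * ((bump L i l - bump L i j : ℝ) : ℂ) * F l by push_cast; ring, enorm_mul, enorm_mul,
    ← ofReal_norm ((bump L i l - bump L i j : ℝ) : ℂ), Complex.norm_real, Real.norm_eq_abs,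
    abs_sub_comm]

theorem coercive_mul_sum_le {M : ℤ → ℤ → ℂ} {α : ℝ} (s : Finset ℤ) (c : ℤ → ℂ)
    (hco : α * ∑ j ∈ s, ‖c j‖ ^ 2 ≤
      (∑ j ∈ s, ∑ l ∈ s, starRingEnd ℂ (c j) * M j l * c l).re) :
    ENNReal.ofReal α * ∑ j ∈ s, ‖c j‖ₑ ^ 2 ≤ ∑ j ∈ s, ‖c j‖ₑ * ‖∑ l ∈ s, M j l * c l‖ₑ := by
  have h1 : α * ∑ j ∈ s, ‖c j‖ ^ 2 ≤ ∑ j ∈ s, ‖c j‖ * ‖∑ l ∈ s, M j l * c l‖ := by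
    refine hco.trans ((Complex.re_le_norm _).trans ((norm_sum_le _ _).trans ?_))
    refine Finset.sum_le_sum fun j _ => ?_
    rw [← RCLike.norm_conj (c j), ← norm_mul, Finset.mul_sum]
    simp only [mul_assoc]
    exact le_rfl
  have h2 := ENNReal.ofReal_le_ofReal h1
  rw [ENNReal.ofReal_mul' (by positivity), ENNReal.ofReal_sum_of_nonneg (fun _ _ => by positivity),
    ENNReal.ofReal_sum_of_nonneg (fun _ _ => by positivity)] at h2
  simpa only [ENNReal.ofReal_mul (norm_nonneg _), ENNReal.ofReal_pow (norm_nonneg _),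
    ofReal_norm] using h2

/-- Coercivity is tested on the finitely supported vector bF. The commutator term is expanded along
diagonals k = j - l; Cauchy–Schwarz on each diagonal produces a product of two local norms, one of
which is then cancelled. -/
theorem mul_locNorm_le {M : ℤ → ℤ → ℂ} {a : ℤ → ℝ≥0∞} {F R : ℤ → ℂ} {α : ℝ} {L : ℕ} {C : ℝ≥0∞}
    (hL : 0 < L) (hMa : ∀ j l, ‖M j l‖ₑ ≤ a (j - l))
    (hco : ∀ (s : Finset ℤ) (c : ℤ → ℂ), α * ∑ j ∈ s, ‖c j‖ ^ 2 ≤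
      (∑ j ∈ s, ∑ l ∈ s, starRingEnd ℂ (c j) * M j l * c l).re)
    (hC : C ≠ ⊤) (hF : ∀ j, ‖F j‖ₑ ≤ C)
    (hMF : ∀ j, HasSum (fun l => M j l * F l) (R j)) (i : ℤ) :
    ENNReal.ofReal α * locNorm L F i ≤
      locNorm L R i + ∑' i', commKernel L a (i - i') * locNorm L F i' := by
  set u : ℤ → ℤ → ℝ≥0∞ := fun i j => ‖(bump L i j : ℂ) * F j‖ₑ with hu
  set w : ℤ → ℝ≥0∞ := fun k => a k * ENNReal.ofReal (min 1 (|(k : ℝ)| / L)) with hw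
  set χ : ℤ → ℤ → ℝ≥0∞ := fun n k => if |k - n * L| < 4 * (L : ℤ) then 1 else 0 with hχ
  have hfin : locNorm L F i ≠ ⊤ := by
    refine ne_top_of_le_ne_top (ENNReal.rpow_ne_top_of_nonneg (by norm_num) ?_)
      (locNorm_le hL hF i)
    exact ENNReal.mul_ne_top (ENNReal.natCast_ne_top _) (ENNReal.pow_ne_top hC)
  set s := Finset.Icc (i * L - 2 * L) (i * (L : ℤ) + 2 * L) with hs
  have h1 : ENNReal.ofReal α * locNorm L F i ^ 2 ≤ ∑' j, u i j * (‖(bump L i j : ℂ) * R j‖ₑ +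
        ∑' l, ‖M j l‖ₑ * ENNReal.ofReal |bump L i j - bump L i l| * ‖F l‖ₑ) := by
    rw [locNorm_sq, tsum_eq_sum (s := s) fun j hj => by simp [bump_eq_zero_of_notMem hL hj]]
    refine (coercive_mul_sum_le s (fun j => (bump L i j : ℂ) * F j) (hco s _)).trans ?_
    refine le_trans (Finset.sum_le_sum fun j _ => ?_) (ENNReal.sum_le_tsum s)
    gcongr
    exact enorm_sum_bump_le hL hMF i j
  have h2 : ∀ j l, u i j * (‖M j l‖ₑ * ENNReal.ofReal |bump L i j - bump L i l| * ‖F l‖ₑ) ≤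
      ∑' i', w (j - l) * χ (i - i') (j - l) * (u i j * u i' l) := by
    intro j l
    by_cases hj : bump L i j = 0
    · simp [hu, hj]
    -- Among all i', the single block containing l suffices, since its bump equals 1 at l. Both
    -- supports have radius below 2L, whence the 4L in `commKernel`.
    · refine le_trans ?_ (ENNReal.le_tsum (l / L))
      have hb := bump_ediv_eq_one hL l
      have e1 := abs_sub_lt_of_bump_ne_zero hL hj
      have e2 := abs_sub_lt_of_bump_ne_zero hL (i := l / L) (j := l) (by simp [hb])
      have e3 : χ (i - l / L) (j - l) = 1 := by
        refine if_pos ?_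
        rw [show j - l - (i - l / L) * L = (j - i * L) - (l - l / L * L) by ring]
        exact (abs_sub _ _).trans_lt (by linarith)
      have e4 : u (l / L) l = ‖F l‖ₑ := by simp [hu, hb]
      rw [e3, e4, mul_one]
      calc u i j * (‖M j l‖ₑ * ENNReal.ofReal |bump L i j - bump L i l| * ‖F l‖ₑ)
          ≤ u i j * (w (j - l) * ‖F l‖ₑ) := by
            gcongr
            exact mul_le_mul' (hMa j l) (ENNReal.ofReal_le_ofReal (abs_bump_sub_bump_le L i j l))
        _ = w (j - l) * (u i j * ‖F l‖ₑ) := by ring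
  have h3 : ∑' j, ∑' l, u i j * (‖M j l‖ₑ * ENNReal.ofReal |bump L i j - bump L i l| * ‖F l‖ₑ) ≤
      locNorm L F i * ∑' i', commKernel L a (i - i') * locNorm L F i' := by
    calc _ ≤ ∑' j, ∑' l, ∑' i', w (j - l) * χ (i - i') (j - l) * (u i j * u i' l) :=
          ENNReal.tsum_le_tsum fun j => ENNReal.tsum_le_tsum fun l => h2 j l
      _ = ∑' j, ∑' k, ∑' i', w k * χ (i - i') k * (u i j * u i' (j - k)) := by
          refine tsum_congr fun j => ?_
          rw [← (Equiv.subLeft j).tsum_eq]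
          simp
      _ = ∑' i', ∑' k, ∑' j, w k * χ (i - i') k * (u i j * u i' (j - k)) := by
          rw [ENNReal.tsum_comm]
          conv_rhs => rw [ENNReal.tsum_comm]
          exact tsum_congr fun k => ENNReal.tsum_comm
      _ ≤ ∑' i', ∑' k, w k * χ (i - i') k * (locNorm L F i * locNorm L F i') := by
          refine ENNReal.tsum_le_tsum fun i' => ENNReal.tsum_le_tsum fun k => ?_
          rw [ENNReal.tsum_mul_left]
          gcongr
          exact tsum_mul_shift_le L F i i' k
      _ = locNorm L F i * ∑' i', commKernel L a (i - i') * locNorm L F i' := by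
          rw [← ENNReal.tsum_mul_left]
          refine tsum_congr fun i' => ?_
          rw [ENNReal.tsum_mul_right, commKernel]
          ring
  have h4 : ∑' j, u i j * ‖(bump L i j : ℂ) * R j‖ₑ ≤ locNorm L F i * locNorm L R i :=
    tsum_mul_le_sqrt_mul_sqrt _ _
  have h5 : locNorm L F i * (ENNReal.ofReal α * locNorm L F i) ≤ locNorm L F i *
      (locNorm L R i + ∑' i', commKernel L a (i - i') * locNorm L F i') := by
    calc _ = ENNReal.ofReal α * locNorm L F i ^ 2 := by ring
      _ ≤ _ := h1
      _ ≤ _ := by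
          simp only [mul_add, ENNReal.tsum_add, ← ENNReal.tsum_mul_left] at h3 ⊢
          exact add_le_add h4 h3
  by_cases h0 : locNorm L F i = 0
  · simp [h0]
  · exact (ENNReal.mul_le_mul_iff_right h0 hfin).1 h5

/-! #### Summability of the commutator kernel -/

/-- The condition puts n in an open interval of length 8 around k/L, which holds at most eight
integers. -/
theorem tsum_near_multiple_le {L : ℕ} (hL : 0 < L) (k : ℤ) :
    ∑' n : ℤ, (if |k - n * L| < 4 * (L : ℤ) then 1 else 0 : ℝ≥0∞) ≤ 8 := by
  have hd := Int.mul_ediv_add_emod k L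
  have hm := Int.emod_nonneg k (b := L) (by omega)
  have hm' := Int.emod_lt_of_pos k (b := (L : ℤ)) (by omega)
  have hL' : (0 : ℤ) < L := by omega
  rw [tsum_eq_sum (s := Finset.Icc (k / L - 3) (k / L + 4)) fun n hn => ?_]
  · refine (Finset.sum_le_card_nsmul _ _ 1 fun n _ => by split_ifs <;> simp).trans ?_
    rw [nsmul_eq_mul, Int.card_Icc, mul_one, show (k / L + 4 + 1 - (k / L - 3)).toNat = 8 by omega]
    norm_num
  · refine if_neg fun h => hn (Finset.mem_Icc.2 ?_)
    rw [abs_lt] at h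
    constructor
    · by_contra! h1
      nlinarith [h.1, h.2]
    · by_contra! h1
      nlinarith [h.1, h.2]

theorem tsum_commKernel_le {L : ℕ} (hL : 0 < L) (a : ℤ → ℝ≥0∞) :
    ∑' n, commKernel L a n ≤ 8 * ∑' k : ℤ, a k * ENNReal.ofReal (min 1 (|(k : ℝ)| / L)) := by
  unfold commKernel
  rw [ENNReal.tsum_comm, ← ENNReal.tsum_mul_left]
  refine ENNReal.tsum_le_tsum fun k => ?_
  rw [ENNReal.tsum_mul_left, mul_comm]
  gcongr
  exact tsum_near_multiple_le hL k

/-- If |n| ≥ K + 4 and |k - nL| < 4L, then |k| > KL ≥ K; this is the reason for the shift by 4. -/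
theorem tail_commKernel_le {L : ℕ} (hL : 0 < L) (a : ℤ → ℝ≥0∞) (K : ℕ) :
    tail (commKernel L a) (K + 4) ≤ 8 * tail a K := by
  have h : ∀ n k : ℤ, (if ((K + 4 : ℕ) : ℤ) ≤ |n| then
      a k * ENNReal.ofReal (min 1 (|(k : ℝ)| / L)) *
        (if |k - n * L| < 4 * (L : ℤ) then 1 else 0) else 0) ≤
      (if (K : ℤ) ≤ |k| then a k else 0) * (if |k - n * L| < 4 * (L : ℤ) then 1 else 0) := by
    intro n k
    split_ifs with h1 h2 h3 <;> try (simp; done)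
    · rw [mul_one, mul_one]
      exact mul_le_of_le_one_right zero_le (ENNReal.ofReal_le_one.2 (min_le_left _ _))
    · exfalso
      have hL' : (1 : ℤ) ≤ L := by omega
      have e1 := abs_sub_abs_le_abs_sub (n * L) k
      rw [abs_sub_comm, abs_mul, Nat.abs_cast] at e1
      push_cast at h1
      nlinarith
  calc tail (commKernel L a) (K + 4)
      ≤ ∑' n : ℤ, ∑' k : ℤ, (if (K : ℤ) ≤ |k| then a k else 0) *
          (if |k - n * L| < 4 * (L : ℤ) then 1 else 0) := by
        refine ENNReal.tsum_le_tsum fun n => ?_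
        unfold commKernel
        split_ifs with h1
        · refine ENNReal.tsum_le_tsum fun k => ?_
          simpa only [if_pos h1] using h n k
        · simp
    _ ≤ ∑' k : ℤ, (if (K : ℤ) ≤ |k| then a k else 0) * 8 := by
        rw [ENNReal.tsum_comm]
        refine ENNReal.tsum_le_tsum fun k => ?_
        rw [ENNReal.tsum_mul_left]
        gcongr
        exact tsum_near_multiple_le hL k
    _ = 8 * tail a K := by rw [ENNReal.tsum_mul_right, tail, mul_comm]

/-- Below N the Lipschitz weight is at most N/L, beyond N at most 1. Choosing N first and L
afterwards makes both terms small. -/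
theorem tsum_mul_min_le {L : ℕ} (a : ℤ → ℝ≥0∞) (N : ℕ) :
    ∑' k : ℤ, a k * ENNReal.ofReal (min 1 (|(k : ℝ)| / L)) ≤
      ENNReal.ofReal (N / L) * ∑' k, a k + tail a N := by
  rw [← ENNReal.tsum_mul_left, tail, ← ENNReal.tsum_add]
  refine ENNReal.tsum_le_tsum fun k => ?_
  split_ifs with h
  · exact le_add_left (mul_le_of_le_one_right zero_le (ENNReal.ofReal_le_one.2 (min_le_left _ _)))
  · rw [add_zero, mul_comm]
    gcongr
    refine (min_le_right _ _).trans ?_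
    have h1 : (|k| : ℝ) ≤ N := by exact_mod_cast (not_le.1 h).le
    gcongr

end Localization

/-! ### Uniform decay of columns of inverse matrices -/

section InverseDecay

theorem enorm_le_locNorm {L : ℕ} (hL : 0 < L) (F : ℤ → ℂ) (j : ℤ) :
    ‖F j‖ₑ ≤ locNorm L F (j / L) := by
  have h : ‖F j‖ₑ ^ 2 ≤ locNorm L F (j / L) ^ 2 := by
    rw [locNorm_sq]
    refine le_trans ?_ (ENNReal.le_tsum j)
    simp [bump_ediv_eq_one hL j]
  exact (ENNReal.pow_le_pow_left_iff two_ne_zero).1 h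

/-- Each block of L consecutive integers is controlled by one local norm, and |j| ≥ L(I + 1) places
j in a block of index at least I in modulus. -/
theorem tail_enorm_le {L : ℕ} (hL : 0 < L) (F : ℤ → ℂ) (I : ℕ) :
    tail (fun j => ‖F j‖ₑ) (L * (I + 1)) ≤ L * tail (locNorm L F) I := by
  have : NeZero L := ⟨hL.ne'⟩
  have hL' : (0 : ℤ) < L := by omega
  calc tail (fun j => ‖F j‖ₑ) (L * (I + 1))
      ≤ ∑' j : ℤ, (if (I : ℤ) ≤ |j / (L : ℤ)| then locNorm L F (j / L) else 0) := by
        refine ENNReal.tsum_le_tsum fun j => ?_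
        split_ifs with h1 h2
        · exact enorm_le_locNorm hL F j
        · exfalso
          have hd := Int.mul_ediv_add_emod j L
          have hm := Int.emod_nonneg j (b := L) (by omega)
          have hm' := Int.emod_lt_of_pos j (b := (L : ℤ)) (by omega)
          have e1 := abs_add_le (L * (j / (L : ℤ))) (j % L)
          rw [hd, abs_mul, Nat.abs_cast, abs_of_nonneg hm] at e1
          push_cast at h1
          nlinarith
        · simp
        · simp
    _ = ∑' q : ℤ × Fin L, (if (I : ℤ) ≤ |q.1| then locNorm L F q.1 else 0) :=
        (Int.divModEquiv L).tsum_eq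
          (fun q : ℤ × Fin L => if (I : ℤ) ≤ |q.1| then locNorm L F q.1 else 0)
    _ = L * tail (locNorm L F) I := by
        rw [ENNReal.tsum_prod (f := fun (i : ℤ) (_ : Fin L) =>
          if (I : ℤ) ≤ |i| then locNorm L F i else 0), tail, ← ENNReal.tsum_mul_left]
        refine tsum_congr fun i => ?_
        rw [tsum_fintype, Finset.sum_const, Finset.card_univ, Fintype.card_fin, nsmul_eq_mul]

theorem locNorm_single_le_one (L : ℕ) (i : ℤ) :
    locNorm L (fun j => if j = 0 then 1 else 0) i ≤ 1 := by
  unfold locNorm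
  rw [tsum_eq_single 0 fun j hj => by simp [hj]]
  refine ENNReal.rpow_le_one (pow_le_one₀ zero_le ?_) (by norm_num)
  simp only [if_true, mul_one]
  rw [← ofReal_norm, Complex.norm_real,
    Real.norm_of_nonneg (bump_nonneg _ _ _)]
  exact ENNReal.ofReal_le_one.2 (bump_le_one _ _ _)

theorem locNorm_single_eq_zero {L : ℕ} {i : ℤ} (hi : 2 ≤ |i|) :
    locNorm L (fun j => if j = 0 then 1 else 0) i = 0 := by
  have h : bump L i 0 = 0 := by
    have : (2 : ℝ) ≤ |(i : ℝ)| := by exact_mod_cast hi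
    refine max_eq_left ((min_le_right _ _).trans ?_)
    simpa using this
  unfold locNorm
  rw [tsum_eq_single 0 fun j hj => by simp [hj]]
  simp [h]

/-- A family of nonnegative sequences with uniformly bounded sums and uniformly small tails. -/
def UniformlySummable {Ω : Type*} (a : Ω → ℤ → ℝ≥0∞) : Prop :=
  (∃ C ≠ ⊤, ∀ ω, ∑' k, a ω k ≤ C) ∧ ∀ ε ≠ 0, ∃ K, ∀ ω, tail (a ω) K ≤ ε

theorem exists_ne_zero_mul_le {c δ : ℝ≥0∞} (hc : c ≠ ⊤) (hδ : δ ≠ 0) :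
    ∃ ε ≠ 0, c * ε ≤ δ :=
  ⟨δ / c, ENNReal.div_ne_zero.2 ⟨hδ, hc⟩, ENNReal.mul_div_le⟩

/-- A scale at which the commutator kernels of a uniformly summable family are small. -/
theorem UniformlySummable.exists_commKernel_le {Ω : Type*} {a : Ω → ℤ → ℝ≥0∞}
    (ha : UniformlySummable a) {δ : ℝ≥0∞} (hδ : δ ≠ 0) :
    ∃ L : ℕ, 0 < L ∧ ∀ ω, ∑' n, commKernel L (a ω) n ≤ δ := by
  obtain ⟨⟨C, hC, haC⟩, hat⟩ := ha
  -- 16 = 8 · 2: the overlap count times the two terms of `tsum_mul_min_le`.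
  obtain ⟨η, hη, hη'⟩ := exists_ne_zero_mul_le (c := 16) (by simp) hδ
  obtain ⟨N, hN⟩ := hat η hη
  have hlim : Filter.Tendsto (fun L : ℕ => ENNReal.ofReal (N / L) * C) Filter.atTop (nhds 0) := by
    have h1 := ENNReal.tendsto_ofReal (tendsto_const_div_atTop_nhds_zero_nat (N : ℝ))
    have h2 := ENNReal.Tendsto.mul_const h1 (Or.inr hC)
    simpa using h2
  obtain ⟨L, hL1, hL0⟩ := ((hlim.eventually_le_const (pos_iff_ne_zero.2 hη)).and
    (Filter.eventually_gt_atTop 0)).exists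
  refine ⟨L, hL0, fun ω => ?_⟩
  calc ∑' n, commKernel L (a ω) n ≤ 8 * (ENNReal.ofReal (N / L) * ∑' k, a ω k + tail (a ω) N) :=
        (tsum_commKernel_le hL0 _).trans (mul_le_mul_right (tsum_mul_min_le _ _) _)
    _ ≤ 8 * (η + η) := by
        gcongr
        · exact (mul_le_mul_right (haC ω) _).trans hL1
        · exact hN ω
    _ = 16 * η := by ring
    _ ≤ δ := hη'

/-- Uniform Wiener lemma: the columns of the inverses of uniformly coercive matrices whose
off-diagonal decay is dominated by a uniformly summable family have uniformly small tails. -/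
theorem exists_tail_enorm_le {Ω : Type*} {M : Ω → ℤ → ℤ → ℂ} {a : Ω → ℤ → ℝ≥0∞}
    {F : Ω → ℤ → ℂ} {α : ℝ} (hα : 0 < α) (ha : UniformlySummable a)
    (hMa : ∀ ω j l, ‖M ω j l‖ₑ ≤ a ω (j - l))
    (hco : ∀ ω (s : Finset ℤ) (c : ℤ → ℂ), α * ∑ j ∈ s, ‖c j‖ ^ 2 ≤
      (∑ j ∈ s, ∑ l ∈ s, starRingEnd ℂ (c j) * M ω j l * c l).re)
    (hF : ∀ ω, ∃ C ≠ ⊤, ∀ j, ‖F ω j‖ₑ ≤ C)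
    (hMF : ∀ ω j, HasSum (fun l => M ω j l * F ω l) (if j = 0 then 1 else 0))
    {ε : ℝ≥0∞} (hε : ε ≠ 0) :
    ∃ K, ∀ ω, tail (fun j => ‖F ω j‖ₑ) K ≤ ε := by
  set β := ENNReal.ofReal α with hβ
  have hβ0 : β ≠ 0 := by simpa [hβ] using hα
  have hβt : β ≠ ⊤ := ENNReal.ofReal_ne_top
  have hβi : β⁻¹ ≠ ⊤ := by simpa using hβ0
  -- After division by the coercivity constant β the kernel has mass at most 1/2. One scale L serves
  -- every ω.
  obtain ⟨L, hL, hker⟩ := ha.exists_commKernel_le (δ := β * 2⁻¹)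
    (mul_ne_zero hβ0 (by simp))
  set δ₀ : ℤ → ℂ := fun j => if j = 0 then 1 else 0 with hδ₀
  set x : Ω → ℤ → ℝ≥0∞ := fun ω => locNorm L (F ω) with hx
  set y : ℤ → ℝ≥0∞ := fun i => β⁻¹ * locNorm L δ₀ i with hy
  set e : Ω → ℤ → ℤ → ℝ≥0∞ := fun ω i i' => β⁻¹ * commKernel L (a ω) (i - i') with he
  have hle : ∀ ω i, x ω i ≤ y i + ∑' i', e ω i i' * x ω i' := by
    intro ω i
    obtain ⟨C, hC, hFC⟩ := hF ω
    have h := mul_locNorm_le hL (hMa ω) (hco ω) hC hFC (hMF ω) i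
    calc x ω i = β⁻¹ * (β * locNorm L (F ω) i) := by
          rw [← mul_assoc, ENNReal.inv_mul_cancel hβ0 hβt, one_mul]
      _ ≤ β⁻¹ * _ := mul_le_mul_right h _
      _ = _ := by
          rw [mul_add, ← ENNReal.tsum_mul_left]
          simp only [he, hy, mul_assoc]
          rfl
  have hsum : ∀ ω, β⁻¹ * ∑' n, commKernel L (a ω) n ≤ 2⁻¹ := by
    intro ω
    refine (mul_le_mul_right (hker ω) _).trans ?_
    rw [← mul_assoc, ENNReal.inv_mul_cancel hβ0 hβt, one_mul]
  have hrow : ∀ ω i, ∑' i', e ω i i' ≤ 2⁻¹ := by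
    intro ω i
    rw [ENNReal.tsum_mul_left]
    refine (mul_le_mul_right ((Equiv.subLeft i).tsum_eq (commKernel L (a ω))).le _).trans ?_
    exact hsum ω
  have hcol : ∀ ω i', ∑' i, e ω i i' ≤ 2⁻¹ := by
    intro ω i'
    rw [ENNReal.tsum_mul_left]
    refine (mul_le_mul_right ((Equiv.subRight i').tsum_eq (commKernel L (a ω))).le _).trans ?_
    exact hsum ω
  have hysum : ∑' i, y i ≤ 3 * β⁻¹ := by
    rw [tsum_eq_sum (s := Finset.Icc (-1) 1) fun i hi => ?_]
    · refine (Finset.sum_le_card_nsmul _ _ β⁻¹ fun i _ =>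
        mul_le_of_le_one_right zero_le (locNorm_single_le_one L i)).trans ?_
      simp
    · have : 2 ≤ |i| := by
        by_contra! h
        have := abs_lt.1 h
        exact hi (Finset.mem_Icc.2 ⟨by omega, by omega⟩)
      rw [hy]
      simp only [hδ₀, locNorm_single_eq_zero this, mul_zero]
  -- 6 = 2 · 3: the Neumann factor times the three indices |i| ≤ 1 at which δ₀ is visible. D is
  -- independent of ω, although the sup bound on `F ω` need not be.
  set D : ℝ≥0∞ := 6 * β⁻¹ with hD
  have hDt : D ≠ ⊤ := ENNReal.mul_ne_top (by simp) hβi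
  have hxD : ∀ ω, ∑' i, x ω i ≤ D := by
    intro ω
    obtain ⟨C, hC, hFC⟩ := hF ω
    refine (tsum_le_of_le_add_kernel (X := ((4 * L + 1 : ℕ) * C ^ 2) ^ (1 / 2 : ℝ)) ?_
      (locNorm_le hL hFC) (hle ω) (hrow ω) (hcol ω)).trans ?_
    · exact ENNReal.rpow_ne_top_of_nonneg (by norm_num)
        (ENNReal.mul_ne_top (ENNReal.natCast_ne_top _) (ENNReal.pow_ne_top hC))
    · calc 2 * ∑' i, y i ≤ 2 * (3 * β⁻¹) := by gcongr
        _ = D := by rw [hD]; ring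
  obtain ⟨δ, hδ, hδε⟩ := exists_ne_zero_mul_le (c := L * 2)
    (ENNReal.mul_ne_top (ENNReal.natCast_ne_top _) (by simp)) hε
  -- Chosen so that the error (∑ x) σ of `tail_two_mul_le`, with σ = β⁻¹ · 8η, is at most δ/2.
  obtain ⟨η, hη, hηδ⟩ := exists_ne_zero_mul_le (c := D * (β⁻¹ * 8)) (δ := 2⁻¹ * δ)
    (ENNReal.mul_ne_top hDt (ENNReal.mul_ne_top hβi (by simp))) (mul_ne_zero (by simp) hδ)
  obtain ⟨K, hK⟩ := ha.2 η hη
  have hstep : ∀ ω J, K + 4 ≤ J → tail (x ω) (2 * J) ≤ 2⁻¹ * tail (x ω) J + 2⁻¹ * δ := by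
    intro ω J hJ
    refine (tail_two_mul_le (y := y) (e := e ω) (σ := β⁻¹ * (8 * η)) (by omega) (fun i hi => ?_)
      (hle ω) (hcol ω) fun i' => ?_).trans ?_
    · simp only [hy, hδ₀, locNorm_single_eq_zero hi, mul_zero]
    · calc ∑' i, (if (J : ℤ) ≤ |i - i'| then e ω i i' else 0)
          = β⁻¹ * tail (commKernel L (a ω)) J := by
            rw [tail, ← (Equiv.subRight i').tsum_eq
              (fun n : ℤ => if (J : ℤ) ≤ |n| then commKernel L (a ω) n else 0), ← ENNReal.tsum_mul_left]
            refine tsum_congr fun i => ?_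
            simp only [Equiv.subRight_apply]
            split_ifs <;> simp [he]
        _ ≤ β⁻¹ * (8 * η) := by
            gcongr
            exact (tail_anti _ hJ).trans ((tail_commKernel_le hL _ K).trans
              (mul_le_mul_right (hK ω) _))
    · refine add_le_add le_rfl ?_
      calc (∑' i, x ω i) * (β⁻¹ * (8 * η)) ≤ D * (β⁻¹ * (8 * η)) := by
            gcongr
            exact hxD ω
        _ = D * (β⁻¹ * 8) * η := by ring
        _ ≤ 2⁻¹ * δ := hηδ
  have hlim : Filter.Tendsto (fun n : ℕ => (2⁻¹ : ℝ≥0∞) ^ n * D) Filter.atTop (nhds 0) := by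
    have h0 : Filter.Tendsto (fun N : ℕ => (2⁻¹ : ℝ≥0∞) ^ N) Filter.atTop (nhds 0) :=
      ENNReal.tendsto_pow_atTop_nhds_zero_of_lt_one (by simp)
    simpa using ENNReal.Tendsto.mul_const h0 (Or.inr hDt)
  obtain ⟨n, hn⟩ := (hlim.eventually_le_const (pos_iff_ne_zero.2 hδ)).exists
  refine ⟨L * (2 ^ n * (K + 4) + 1), fun ω => ?_⟩
  calc tail (fun j => ‖F ω j‖ₑ) (L * (2 ^ n * (K + 4) + 1))
      ≤ L * tail (x ω) (2 ^ n * (K + 4)) := tail_enorm_le hL (F ω) _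
    _ ≤ L * (2⁻¹ ^ n * D + δ) := by
        gcongr
        exact tail_two_pow_mul_le (hxD ω) (hstep ω) n
    _ ≤ L * (δ + δ) := by gcongr
    _ = L * 2 * δ := by ring
    _ ≤ ε := hδε

end InverseDecay

/-! ### Frame operators and canonical duals -/

section FrameOperators

variable {ι H : Type*} [NormedAddCommGroup H] [InnerProductSpace ℂ H] [CompleteSpace H]

theorem HasUpperFrameBound.hasSum_inner_frameOperator {φ : ι → H} (h : HasUpperFrameBound φ)
    (f u : H) :
    HasSum (fun i => inner ℂ (φ i) f * inner ℂ u (φ i)) (inner ℂ u (frameOperator φ f)) := by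
  simpa only [innerSL_apply_apply, inner_smul_right] using
    (h.hasSum_frameOperator f).mapL (innerSL ℂ u)

theorem HasUpperFrameBound.inner_frameOperator_comm {φ : ι → H} (h : HasUpperFrameBound φ)
    (f u : H) : inner ℂ (frameOperator φ u) f = inner ℂ u (frameOperator φ f) := by
  have h1 := h.hasSum_inner_frameOperator f u
  have h2 := (h.hasSum_inner_frameOperator u f).star
  refine HasSum.unique ?_ h1
  rw [← inner_conj_symm]
  refine h2.congr_fun fun i => ?_
  simp [mul_comm]

theorem HasUpperFrameBound.re_inner_frameOperator {φ : ι → H} (h : HasUpperFrameBound φ) (f : H) :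
    (inner ℂ f (frameOperator φ f)).re = ∑' i, ‖inner ℂ (φ i) f‖ ^ 2 := by
  have h1 := Complex.hasSum_re (h.hasSum_inner_frameOperator f f)
  rw [← h1.tsum_eq]
  refine tsum_congr fun i => ?_
  rw [← inner_conj_symm f (φ i), Complex.mul_conj', ← Complex.ofReal_pow, Complex.ofReal_re]

theorem IsFrame.frameOperator_symm {φ : ι → H} (h : IsFrame φ) (f : H) :
    frameOperator φ (h.frameEquiv.symm f) = f :=
  h.frameEquiv.apply_symm_apply f

theorem IsFrame.inner_symm {φ : ι → H} (h : IsFrame φ) (f u : H) :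
    inner ℂ (h.frameEquiv.symm u) f = inner ℂ u (h.frameEquiv.symm f) := by
  conv_lhs => rw [← h.frameOperator_symm f]
  rw [← h.hasUpperFrameBound.inner_frameOperator_comm, h.frameOperator_symm]

/-- By self-adjointness the coefficients of f against the dual are those of S⁻¹f against φ, and the
lower frame bound gives ‖S⁻¹f‖ ≤ A⁻¹‖f‖. -/
theorem IsFrame.hasUpperFrameBound_dual {φ : ι → H} (h : IsFrame φ) :
    HasUpperFrameBound (fun i => h.frameEquiv.symm (φ i)) := by
  obtain ⟨A, B, hA, hB, hAB⟩ := id h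
  refine ⟨B * (A⁻¹) ^ 2, by positivity, fun f => ?_⟩
  simp only [h.inner_symm]
  obtain ⟨h1, h2, h3⟩ := hAB (h.frameEquiv.symm f)
  refine ⟨h1, h3.trans ?_⟩
  have h4 : A * ‖h.frameEquiv.symm f‖ ^ 2 ≤ ‖h.frameEquiv.symm f‖ * ‖f‖ := by
    rw [← h.hasUpperFrameBound.re_inner_frameOperator, h.frameOperator_symm] at h2
    exact h2.trans (re_inner_le_norm (𝕜 := ℂ) _ _)
  have h5 : ‖h.frameEquiv.symm f‖ ≤ A⁻¹ * ‖f‖ := by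
    rcases (norm_nonneg (h.frameEquiv.symm f)).eq_or_lt with h0 | h0
    · rw [← h0]
      positivity
    · rw [inv_mul_eq_div, le_div_iff₀ hA]
      nlinarith
  rw [mul_assoc, ← mul_pow]
  gcongr

/-- The frame operator of the canonical dual is the inverse of the frame operator. -/
theorem IsFrame.frameOperator_dual {φ : ι → H} (h : IsFrame φ) (f : H) :
    frameOperator (fun i => h.frameEquiv.symm (φ i)) f = h.frameEquiv.symm f := by
  obtain ⟨S, hS⟩ := h.hasUpperFrameBound.exists_clm
  have hSe : ∀ u, frameOperator φ u = S u := fun u => (hS u).tsum_eq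
  apply h.frameEquiv.injective
  rw [Equiv.apply_symm_apply]
  change frameOperator φ _ = f
  -- Applying S to the dual expansion of f turns it into the φ-expansion of S(S⁻¹f) = f.
  have h1 := (h.hasUpperFrameBound_dual.hasSum_frameOperator f).mapL S
  have h2 : ∀ i, S (h.frameEquiv.symm (φ i)) = φ i := fun i => by
    rw [← hSe, h.frameOperator_symm]
  simp only [map_smul, h2, h.inner_symm] at h1
  rw [← hSe] at h1
  rw [← h1.tsum_eq]
  exact h.frameOperator_symm f

end FrameOperators

/-! ### Time-frequency shifts -/

section Shifts

theorem coeFn_modTrans (ω x : ℝ) (g : L2R) :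
    modTrans ω x g =ᵐ[volume]
      fun t : ℝ => Complex.exp (2 * Real.pi * Complex.I * ω * t) * g (t - x) :=
  MemLp.coeFn_toLp _

theorem ae_comp_sub {p : ℝ → Prop} (h : ∀ᵐ t, p t) (x : ℝ) : ∀ᵐ t, p (t - x) :=
  (measurePreserving_sub_right volume x).quasiMeasurePreserving.ae h

theorem ae_comp_add {p : ℝ → Prop} (h : ∀ᵐ t, p t) (x : ℝ) : ∀ᵐ t, p (t + x) :=
  (measurePreserving_add_right volume x).quasiMeasurePreserving.ae h

theorem norm_exp_mul (ω t : ℝ) : ‖Complex.exp (2 * Real.pi * Complex.I * ω * t)‖ = 1 := by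
  have : (2 * Real.pi * Complex.I * ω * t : ℂ) = ((2 * Real.pi * ω * t : ℝ) : ℂ) * Complex.I := by
    push_cast
    ring
  rw [this, Complex.norm_exp_ofReal_mul_I]

theorem norm_modTrans (ω x : ℝ) (g : L2R) : ‖modTrans ω x g‖ = ‖g‖ := by
  rw [modTrans, Lp.norm_toLp, Lp.norm_def]
  congr 1
  rw [← eLpNorm_comp_measurePreserving (Lp.aestronglyMeasurable g)
    (measurePreserving_sub_right volume x)]
  refine eLpNorm_congr_norm_ae (Filter.Eventually.of_forall fun t => ?_)
  simp [norm_exp_mul]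

/-- Time-frequency shifts as linear isometries. -/
def modTransₗᵢ (ω x : ℝ) : L2R →ₗᵢ[ℂ] L2R where
  toFun := modTrans ω x
  map_add' f g := by
    ext1
    filter_upwards [coeFn_modTrans ω x (f + g), coeFn_modTrans ω x f, coeFn_modTrans ω x g,
      Lp.coeFn_add (modTrans ω x f) (modTrans ω x g), ae_comp_sub (Lp.coeFn_add f g) x]
      with t h1 h2 h3 h4 h5
    rw [h1, h4, Pi.add_apply, h2, h3, h5, Pi.add_apply, mul_add]
  map_smul' c f := by
    ext1
    filter_upwards [coeFn_modTrans ω x (c • f), coeFn_modTrans ω x f,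
      Lp.coeFn_smul c (modTrans ω x f), ae_comp_sub (Lp.coeFn_smul c f) x] with t h1 h2 h4 h5
    rw [h1, RingHom.id_apply, h4, Pi.smul_apply, h2, h5, Pi.smul_apply, smul_eq_mul, smul_eq_mul,
      mul_left_comm]
  norm_map' := norm_modTrans ω x

theorem modTransₗᵢ_apply (ω x : ℝ) (g : L2R) : modTransₗᵢ ω x g = modTrans ω x g := rfl

theorem modTrans_modTrans (ω ω' x x' : ℝ) (g : L2R) :
    modTrans ω x (modTrans ω' x' g) =
      Complex.exp (2 * Real.pi * Complex.I * ω' * (-x : ℝ)) • modTrans (ω + ω') (x + x') g := by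
  ext1
  filter_upwards [coeFn_modTrans ω x (modTrans ω' x' g), ae_comp_sub (coeFn_modTrans ω' x' g) x,
    coeFn_modTrans (ω + ω') (x + x') g,
    Lp.coeFn_smul (Complex.exp (2 * Real.pi * Complex.I * ω' * (-x : ℝ)))
      (modTrans (ω + ω') (x + x') g)] with t h1 h2 h3 h4
  rw [h1, h2, h4, Pi.smul_apply, h3, smul_eq_mul, ← mul_assoc, ← mul_assoc, ← Complex.exp_add,
    ← Complex.exp_add, sub_sub]
  congr 2
  push_cast
  ring

/-- A lattice shift permutes the system up to unimodular factors, which cancel in each term ⟨f, φ⟩φ.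
-/
theorem frameOperator_modTrans {g : L2R} {a b : ℝ} (h : HasUpperFrameBound (whSystem g a b))
    (m n : ℤ) (f : L2R) :
    frameOperator (whSystem g a b) (modTrans (m * b) (n * a) f) =
      modTrans (m * b) (n * a) (frameOperator (whSystem g a b) f) := by
  set U := modTransₗᵢ (m * b) (n * a) with hU
  have h1 := (h.hasSum_frameOperator f).mapL U.toContinuousLinearMap
  have h2 := (Equiv.addRight ((m, n) : ℤ × ℤ)).hasSum_iff.2
    (h.hasSum_frameOperator (modTrans (m * b) (n * a) f))
  refine h2.unique (HasSum.congr_fun h1 fun i => ?_)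
  obtain ⟨m', n'⟩ := i
  have h3 : whSystem g a b ((m', n') + (m, n)) =
      (Complex.exp (2 * Real.pi * Complex.I * (m' * b : ℝ) * (-(n * a) : ℝ)))⁻¹ •
        U (whSystem g a b (m', n')) := by
    rw [hU, modTransₗᵢ_apply, whSystem, whSystem, modTrans_modTrans, smul_smul,
      inv_mul_cancel₀ (Complex.exp_ne_zero _), one_smul]
    simp only [Prod.mk_add_mk]
    congr 1 <;> push_cast <;> ring
  set c := (Complex.exp (2 * Real.pi * Complex.I * (m' * b : ℝ) * (-(n * a) : ℝ)))⁻¹ with hc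
  have hc1 : starRingEnd ℂ c * c = 1 := by
    rw [RCLike.conj_mul, hc, norm_inv, norm_exp_mul]
    simp
  simp only [Function.comp_apply, Equiv.coe_addRight, h3]
  change inner ℂ (c • U (whSystem g a b (m', n'))) (U f) • c • U (whSystem g a b (m', n')) =
    U (inner ℂ (whSystem g a b (m', n')) f • whSystem g a b (m', n'))
  rw [inner_smul_left, U.inner_map_map, smul_smul, map_smul, mul_right_comm, hc1, one_mul]

theorem whSystem_dual {g : L2R} {a b : ℝ} (hg : IsFrame (whSystem g a b)) :
    whSystem (hg.frameEquiv.symm g) a b = fun i => hg.frameEquiv.symm (whSystem g a b i) := by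
  funext i
  apply hg.frameEquiv.injective
  rw [Equiv.apply_symm_apply]
  change frameOperator _ (modTrans _ _ _) = _
  rw [frameOperator_modTrans hg.hasUpperFrameBound, hg.frameOperator_symm]
  rfl

end Shifts

/-! ### Periodization and Parseval's identity on an interval -/

section Preliminaries

theorem ae_summable_and_integrable_tsum {α ι : Type*} [MeasurableSpace α] {μ : Measure α}
    [Countable ι] {F : ι → α → ℂ} (hF : ∀ i, AEStronglyMeasurable (F i) μ)
    (h : ∑' i, ∫⁻ t, ‖F i t‖ₑ ∂μ ≠ ⊤) :
    (∀ᵐ t ∂μ, Summable fun i => F i t) ∧ Integrable (fun t => ∑' i, F i t) μ ∧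
      HasSum (fun i => ∫ t, F i t ∂μ) (∫ t, ∑' i, F i t ∂μ) := by
  have h1 : ∫⁻ t, ∑' i, ‖F i t‖ₑ ∂μ ≠ ⊤ := by rwa [lintegral_tsum fun i => (hF i).enorm]
  refine ⟨?_, ⟨?_, ?_⟩, ?_⟩
  · filter_upwards [ae_lt_top' (AEMeasurable.tsum fun i => (hF i).enorm) h1] with t ht
    exact (tsum_enorm_ne_top_iff_summable_norm.1 ht.ne).of_norm
  · exact (AEMeasurable.tsum fun i => (hF i).aemeasurable).aestronglyMeasurable
  · exact (lintegral_mono fun t => enorm_tsum_le_tsum_enorm).trans_lt h1.lt_top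
  · rw [integral_tsum hF h]
    refine Summable.hasSum (Summable.of_norm ?_)
    refine tsum_enorm_ne_top_iff_summable_norm.1 (ne_top_of_le_ne_top h ?_)
    exact ENNReal.tsum_le_tsum fun i => enorm_integral_le_lintegral_enorm _

/-- Parseval for the Fourier basis of a circle of length 1/b. -/
theorem hasSum_conj_integral_mul_integral {b : ℝ} (hb : 0 < b) (x : ℝ) {p q : ℝ → ℂ}
    (hp : MemLp p 2 (volume.restrict (Set.Ioc x (x + 1 / b))))
    (hq : MemLp q 2 (volume.restrict (Set.Ioc x (x + 1 / b)))) :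
    HasSum (fun m : ℤ =>
      starRingEnd ℂ (∫ t in Set.Ioc x (x + 1 / b),
        Complex.exp (2 * Real.pi * Complex.I * (m * b : ℝ) * t) * q t) *
      ∫ t in Set.Ioc x (x + 1 / b),
        Complex.exp (2 * Real.pi * Complex.I * (m * b : ℝ) * t) * p t)
      ((1 / b : ℝ) * ∫ t in Set.Ioc x (x + 1 / b), starRingEnd ℂ (q t) * p t) := by
  set T := 1 / b with hT
  have hT0 : 0 < T := by positivity
  have : Fact (0 < T) := ⟨hT0⟩
  have hTc : (T : ℂ) ≠ 0 := by exact_mod_cast hT0.ne'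
  have hP := hp.memLp_liftIoc.haarAddCircle
  have hQ := hq.memLp_liftIoc.haarAddCircle
  have hcoef : ∀ {r : ℝ → ℂ} (hr : MemLp (AddCircle.liftIoc T x r) 2 AddCircle.haarAddCircle)
      (i : ℤ), inner ℂ (fourierBasis (T := T) i) (MemLp.toLp _ hr) = (T : ℂ)⁻¹ *
        ∫ t in Set.Ioc x (x + T),
          Complex.exp (2 * Real.pi * Complex.I * ((-i : ℤ) * b : ℝ) * t) * r t := by
    intro r hr i
    rw [← HilbertBasis.repr_apply_apply, fourierBasis_repr, fourierCoeff_congr_ae hr.coeFn_toLp,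
      fourierCoeff_eq_intervalIntegral _ _ x, intervalIntegral.integral_of_le (by linarith)]
    rw [← Complex.coe_smul, smul_eq_mul]
    congr 1
    · push_cast; rw [one_div]
    · refine setIntegral_congr_fun measurableSet_Ioc fun t ht => ?_
      rw [AddCircle.liftIoc_coe_apply ht, fourier_coe_apply, smul_eq_mul]
      congr 2
      rw [hT]
      push_cast
      field_simp
  set P : Lp ℂ 2 (AddCircle.haarAddCircle (T := T)) := MemLp.toLp _ hP with hPdef
  set Q : Lp ℂ 2 (AddCircle.haarAddCircle (T := T)) := MemLp.toLp _ hQ with hQdef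
  have h := (fourierBasis (T := T)).hasSum_inner_mul_inner Q P
  have hinner : inner ℂ Q P =
      (T : ℂ)⁻¹ * ∫ t in Set.Ioc x (x + T), starRingEnd ℂ (q t) * p t := by
    have h1 : inner ℂ Q P =
        ∫ t, AddCircle.liftIoc T x (fun t => starRingEnd ℂ (q t) * p t) t
          ∂AddCircle.haarAddCircle := by
      rw [L2.inner_def]
      refine integral_congr_ae ?_
      filter_upwards [hQ.coeFn_toLp, hP.coeFn_toLp] with t h1 h2
      rw [hPdef, hQdef, h1, h2, RCLike.inner_apply']
      rfl
    rw [h1, AddCircle.integral_haarAddCircle, AddCircle.integral_liftIoc_eq_intervalIntegral,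
      intervalIntegral.integral_of_le (by linarith), ← Complex.coe_smul, smul_eq_mul,
      Complex.ofReal_inv]
  rw [hinner] at h
  -- Fourier coefficients pair with the conjugate exponential, hence the sign change; T · T removes
  -- the normalisation T⁻¹ of the two coefficients.
  have h2 := ((Equiv.neg ℤ).hasSum_iff.2 h).mul_left ((T : ℂ) * T)
  have hval : ∀ z : ℂ, (T : ℂ) * z = T * T * ((T : ℂ)⁻¹ * z) := fun z => by field_simp
  rw [hval]
  refine HasSum.congr_fun h2 fun m => ?_
  simp only [Function.comp_apply, Equiv.neg_apply]
  rw [← inner_conj_symm Q, hcoef hQ, hcoef hP, neg_neg, map_mul, map_inv₀,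
    Complex.conj_ofReal]
  field_simp

theorem tsum_indicator_le {a : ℝ} (ha : 0 < a) (x T v : ℝ) :
    ∑' n : ℤ, (Set.Ioc x (x + T)).indicator (fun _ => (1 : ℝ≥0∞)) (v + n * a) ≤
      (⌈T / a⌉₊ + 2 : ℕ) := by
  have h0 : ∀ n ∉ Finset.Icc ⌊(x - v) / a⌋ ⌊(x + T - v) / a⌋,
      (Set.Ioc x (x + T)).indicator (fun _ => (1 : ℝ≥0∞)) (v + n * a) = 0 := by
    intro n hn
    refine Set.indicator_of_notMem (fun h => hn (Finset.mem_Icc.2 ⟨?_, ?_⟩)) _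
    · rw [← Int.cast_le (R := ℝ)]
      refine (Int.floor_le _).trans ?_
      rw [div_le_iff₀ ha]
      linarith [h.1]
    · rw [Int.le_floor, le_div_iff₀ ha]
      linarith [h.2]
  rw [tsum_eq_sum h0]
  refine (Finset.sum_le_card_nsmul _ _ 1 fun n _ => ?_).trans ?_
  · by_cases h : v + n * a ∈ Set.Ioc x (x + T) <;> simp [h]
  rw [nsmul_eq_mul, mul_one, Int.card_Icc]
  have h1 : (⌊(x + T - v) / a⌋ : ℝ) ≤ (x + T - v) / a := Int.floor_le _
  have h2 : (x - v) / a < ⌊(x - v) / a⌋ + 1 := Int.lt_floor_add_one _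
  have h3 : T / a ≤ ⌈T / a⌉₊ := Nat.le_ceil _
  have h4 : (x + T - v) / a = (x - v) / a + T / a := by ring
  have h5 : (⌊(x + T - v) / a⌋ : ℝ) < ⌊(x - v) / a⌋ + 1 + (⌈T / a⌉₊ : ℤ) := by
    push_cast
    linarith
  have h6 : ⌊(x + T - v) / a⌋ < ⌊(x - v) / a⌋ + 1 + (⌈T / a⌉₊ : ℤ) := by exact_mod_cast h5
  exact_mod_cast (by omega :
    (⌊(x + T - v) / a⌋ + 1 - ⌊(x - v) / a⌋).toNat ≤ ⌈T / a⌉₊ + 2)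

theorem lintegral_enorm_sq_ne_top (g : L2R) : ∫⁻ t, ‖g t‖ₑ ^ 2 ≠ ⊤ := by
  have h := (Lp.memLp g).eLpNorm_lt_top
  rw [eLpNorm_eq_lintegral_rpow_enorm_toReal (by simp) (by simp)] at h
  have h2 := (ENNReal.rpow_lt_top_iff_of_pos (by simp)).1 h
  simpa using h2.ne

/-- The translates of an interval by aℤ cover each point boundedly often, so the sum is at most a
multiple of ‖g‖². -/
theorem tsum_lintegral_translates_ne_top {a : ℝ} (ha : 0 < a) (x T s : ℝ) (g : L2R) :
    ∑' n : ℤ, ∫⁻ t in Set.Ioc x (x + T), ‖g (t + s - n * a)‖ₑ ^ 2 ≠ ⊤ := by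
  have hm : AEMeasurable (fun u => ‖g u‖ₑ ^ 2) volume :=
    (Lp.aestronglyMeasurable g).enorm.pow_const 2
  have h1 : ∀ n : ℤ, ∫⁻ t in Set.Ioc x (x + T), ‖g (t + s - n * a)‖ₑ ^ 2 =
      ∫⁻ u, (Set.Ioc x (x + T)).indicator (fun _ => (1 : ℝ≥0∞)) (u - s + n * a) *
        ‖g u‖ₑ ^ 2 := by
    intro n
    rw [← lintegral_indicator measurableSet_Ioc,
      ← lintegral_add_right_eq_self _ (s - n * a)]
    rw [← lintegral_add_right_eq_self (fun u => (Set.Ioc x (x + T)).indicator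
      (fun _ => (1 : ℝ≥0∞)) (u - s + n * a) * ‖g u‖ₑ ^ 2) (s - n * a + (s - n * a))]
    refine lintegral_congr fun t => ?_
    rw [show t + (s - n * a + (s - n * a)) - s + n * a = t + (s - n * a) by ring,
      show t + (s - n * a + (s - n * a)) = t + (s - n * a) + s - n * a by ring]
    by_cases h : t + (s - n * a) ∈ Set.Ioc x (x + T) <;> simp [h]
  simp only [h1]
  rw [← lintegral_tsum fun n => ?_]
  · refine ne_top_of_le_ne_top (ENNReal.mul_ne_top (ENNReal.natCast_ne_top (⌈T / a⌉₊ + 2))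
      (lintegral_enorm_sq_ne_top g)) ?_
    rw [← lintegral_const_mul'' _ hm]
    refine lintegral_mono fun u => ?_
    rw [ENNReal.tsum_mul_right]
    gcongr
    exact tsum_indicator_le ha x T (u - s)
  · refine AEMeasurable.mul (Measurable.aemeasurable ?_) hm
    exact (measurable_const.indicator measurableSet_Ioc).comp (by fun_prop)

end Preliminaries

/-! ### The fibre matrices of a Weyl–Heisenberg frame operator -/

section Fibers

/-- The matrix of the frame operator of `(g, a, b)` on the fibre `t + ℤ / b`. -/
def fiberMatrix (g : L2R) (a b t : ℝ) (j l : ℤ) : ℂ :=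
  (1 / b : ℝ) * corr g a b (j - l) (t + j / b)

theorem fiberMatrix_eq (g : L2R) (a b t : ℝ) (j l : ℤ) :
    fiberMatrix g a b t j l =
      (1 / b : ℝ) * ∑' n : ℤ, g (t + j / b - n * a) * starRingEnd ℂ (g (t + l / b - n * a)) := by
  unfold fiberMatrix corr
  congr 2
  funext n
  congr 3
  push_cast
  ring

theorem aestronglyMeasurable_translate (g : L2R) (s : ℝ) :
    AEStronglyMeasurable (fun t => g (t + s)) volume :=
  (Lp.aestronglyMeasurable g).comp_measurePreserving (measurePreserving_add_right volume s)

theorem memLp_translate (g : L2R) (s : ℝ) : MemLp (fun t => g (t + s)) 2 volume :=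
  (Lp.memLp g).comp_measurePreserving (measurePreserving_add_right volume s)

theorem tsum_lintegral_correlation_ne_top {a : ℝ} (ha : 0 < a) (x T s s' : ℝ) (g : L2R) :
    ∑' n : ℤ, ∫⁻ t in Set.Ioc x (x + T),
      ‖g (t + s - n * a) * starRingEnd ℂ (g (t + s' - n * a))‖ₑ ≠ ⊤ := by
  refine ne_top_of_le_ne_top (ENNReal.add_ne_top.2 ⟨tsum_lintegral_translates_ne_top ha x T s g,
    tsum_lintegral_translates_ne_top ha x T s' g⟩) ?_
  rw [← ENNReal.tsum_add]
  refine ENNReal.tsum_le_tsum fun n => ?_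
  rw [← lintegral_add_left']
  · refine lintegral_mono fun t => ?_
    rw [enorm_mul, RCLike.enorm_conj]
    rcases le_total ‖g (t + s - n * a)‖ₑ ‖g (t + s' - n * a)‖ₑ with h | h
    · exact le_add_left (by rw [sq]; gcongr)
    · exact le_add_right (by rw [sq]; gcongr)
  · simp only [add_sub_assoc]
    exact ((aestronglyMeasurable_translate g _).enorm.pow_const 2).restrict

theorem correlation_properties {a : ℝ} (ha : 0 < a) (x T s s' : ℝ) (g : L2R) {D : Set ℝ}
    (hD : D ⊆ Set.Ioc x (x + T)) :
    (∀ᵐ t ∂volume.restrict D, Summable fun n : ℤ =>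
      g (t + s - n * a) * starRingEnd ℂ (g (t + s' - n * a))) ∧
    Integrable (fun t => ∑' n : ℤ, g (t + s - n * a) * starRingEnd ℂ (g (t + s' - n * a)))
      (volume.restrict D) ∧
    HasSum (fun n : ℤ => ∫ t in D, g (t + s - n * a) * starRingEnd ℂ (g (t + s' - n * a)))
      (∫ t in D, ∑' n : ℤ, g (t + s - n * a) * starRingEnd ℂ (g (t + s' - n * a))) := by
  refine ae_summable_and_integrable_tsum (fun n => ?_) ?_
  · simp only [add_sub_assoc]
    exact ((aestronglyMeasurable_translate g _).mul
      (Complex.continuous_conj.comp_aestronglyMeasurable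
        (aestronglyMeasurable_translate g _))).restrict
  · refine ne_top_of_le_ne_top (tsum_lintegral_correlation_ne_top ha x T s s' g) ?_
    exact ENNReal.tsum_le_tsum fun n => lintegral_mono_set hD

theorem integrableOn_fiberMatrix {a : ℝ} (ha : 0 < a) (b x T : ℝ) (g : L2R) (j l : ℤ) :
    IntegrableOn (fun t => fiberMatrix g a b t j l) (Set.Ioc x (x + T)) := by
  simp only [fiberMatrix_eq]
  exact (correlation_properties ha x T _ _ g subset_rfl).2.1.const_mul _

/-- The indicator function of the translate `D + y` in `L²(ℝ)`. -/
def shiftInd {D : Set ℝ} (hD : MeasurableSet D) (hD' : volume D ≠ ⊤) (y : ℝ) : L2R :=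
  indicatorConstLp 2 (s := (fun t => t - y) ⁻¹' D) (hD.preimage (measurable_id.sub_const y))
    (by rwa [(measurePreserving_sub_right volume y).measure_preimage hD.nullMeasurableSet]) 1

theorem inner_shiftInd {D : Set ℝ} (hD : MeasurableSet D) (hD' : volume D ≠ ⊤) (y : ℝ) (f : L2R) :
    inner ℂ (shiftInd hD hD' y) f = ∫ t in D, f (t + y) := by
  rw [shiftInd, L2.inner_indicatorConstLp_one,
    ← (measurePreserving_add_right volume y).setIntegral_preimage_emb
      (MeasurableEquiv.addRight y).measurableEmbedding]
  congr 2
  ext t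
  simp

theorem coeFn_shiftInd {D : Set ℝ} (hD : MeasurableSet D) (hD' : volume D ≠ ⊤) (y : ℝ) :
    ∀ᵐ t, shiftInd hD hD' y (t + y) = D.indicator (fun _ => (1 : ℂ)) t := by
  have h : shiftInd hD hD' y =ᵐ[volume]
      ((fun t => t - y) ⁻¹' D).indicator fun _ => (1 : ℂ) := indicatorConstLp_coeFn
  filter_upwards [ae_comp_add h y] with t ht
  rw [ht]
  by_cases hm : t ∈ D <;> simp [hm]

/-- This periodicity is what makes the frame operator decompose over the fibres t + ℤ/b. -/
theorem exp_mul_add_int_div {b : ℝ} (hb : 0 < b) (m j : ℤ) (t : ℝ) :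
    Complex.exp (2 * Real.pi * Complex.I * (m * b : ℝ) * (t + j / b : ℝ)) =
      Complex.exp (2 * Real.pi * Complex.I * (m * b : ℝ) * t) := by
  have hb' : (b : ℂ) ≠ 0 := by exact_mod_cast hb.ne'
  rw [Complex.exp_eq_exp_iff_exists_int]
  refine ⟨m * j, ?_⟩
  push_cast
  field_simp

theorem inner_shiftInd_whSystem {b : ℝ} (hb : 0 < b) (a x : ℝ) (g : L2R) {D : Set ℝ}
    (hD : MeasurableSet D) (hD' : volume D ≠ ⊤) (hDJ : D ⊆ Set.Ioc x (x + 1 / b)) (j m n : ℤ) :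
    inner ℂ (shiftInd hD hD' (j / b)) (whSystem g a b (m, n)) =
      ∫ t in Set.Ioc x (x + 1 / b), Complex.exp (2 * Real.pi * Complex.I * (m * b : ℝ) * t) *
        D.indicator (fun t => g (t + (j / b - n * a))) t := by
  rw [inner_shiftInd]
  have h1 : ∀ t : ℝ, Complex.exp (2 * Real.pi * Complex.I * (m * b : ℝ) * t) *
        D.indicator (fun t => g (t + (j / b - n * a))) t =
      D.indicator (fun t => Complex.exp (2 * Real.pi * Complex.I * (m * b : ℝ) * t) *
        g (t + (j / b - n * a))) t := by
    intro t
    by_cases ht : t ∈ D <;> simp [ht]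
  simp only [h1]
  rw [setIntegral_indicator hD, Set.inter_eq_right.2 hDJ]
  refine setIntegral_congr_ae hD ?_
  filter_upwards [ae_comp_add (coeFn_modTrans (m * b) (n * a) g) (j / b)] with t ht _
  simp only [whSystem]
  rw [ht, exp_mul_add_int_div hb, add_sub_assoc]

theorem inner_shiftInd_frameOperator {a b : ℝ} (ha : 0 < a) (hb : 0 < b) {g : L2R}
    (h : HasUpperFrameBound (whSystem g a b)) (x : ℝ) {D E : Set ℝ}
    (hD : MeasurableSet D) (hD' : volume D ≠ ⊤) (hDJ : D ⊆ Set.Ioc x (x + 1 / b))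
    (hE : MeasurableSet E) (hE' : volume E ≠ ⊤) (hEJ : E ⊆ Set.Ioc x (x + 1 / b)) (j l : ℤ) :
    inner ℂ (shiftInd hD hD' (j / b)) (frameOperator (whSystem g a b) (shiftInd hE hE' (l / b))) =
      ∫ t in D ∩ E, fiberMatrix g a b t j l := by
  -- The coordinates are swapped so that m is summed first, by Parseval on one cell; the sum over n
  -- then yields the correlation function.
  have h1 := (Equiv.prodComm ℤ ℤ).hasSum_iff.2 (h.hasSum_inner_frameOperator
    (shiftInd hE hE' (l / b)) (shiftInd hD hD' (j / b)))
  have hmem : ∀ {D : Set ℝ} (_ : MeasurableSet D) (s : ℝ),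
      MemLp (D.indicator fun t => g (t + s)) 2 (volume.restrict (Set.Ioc x (x + 1 / b))) :=
    fun hD s => ((memLp_translate g s).indicator hD).restrict _
  have hn : ∀ n : ℤ, HasSum (fun m : ℤ =>
      inner ℂ (whSystem g a b (m, n)) (shiftInd hE hE' (l / b)) *
        inner ℂ (shiftInd hD hD' (j / b)) (whSystem g a b (m, n)))
      ((1 / b : ℝ) * ∫ t in Set.Ioc x (x + 1 / b),
        starRingEnd ℂ (E.indicator (fun t => g (t + (l / b - n * a))) t) *
        D.indicator (fun t => g (t + (j / b - n * a))) t) := by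
    intro n
    refine (hasSum_conj_integral_mul_integral hb x (hmem hD (j / b - n * a))
      (hmem hE (l / b - n * a))).congr_fun fun m => ?_
    rw [← inner_conj_symm (whSystem g a b (m, n)), inner_shiftInd_whSystem hb a x g hD hD' hDJ,
      inner_shiftInd_whSystem hb a x g hE hE' hEJ]
  have h2 := h1.prod_fiberwise hn
  refine h2.unique ?_
  simp only [fiberMatrix_eq]
  rw [integral_const_mul]
  refine ((correlation_properties ha x (1 / b) (j / b) (l / b) g
    (Set.inter_subset_left.trans hDJ)).2.2.mul_left _).congr_fun fun n => ?_
  congr 1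
  have h3 : ∀ t : ℝ, starRingEnd ℂ (E.indicator (fun t => g (t + (l / b - n * a))) t) *
      D.indicator (fun t => g (t + (j / b - n * a))) t =
      (D ∩ E).indicator (fun t => g (t + j / b - n * a) *
        starRingEnd ℂ (g (t + l / b - n * a))) t := by
    intro t
    by_cases hd : t ∈ D <;> by_cases he : t ∈ E <;> simp [hd, he, add_sub_assoc, mul_comm]
  simp only [h3]
  rw [setIntegral_indicator (hD.inter hE),
    Set.inter_eq_right.2 (Set.inter_subset_left.trans hDJ)]

end Fibers

/-! ### Action of the frame operator on fibres -/

section Walnut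

theorem conj_fiberMatrix (g : L2R) (a b t : ℝ) (j l : ℤ) :
    starRingEnd ℂ (fiberMatrix g a b t j l) = fiberMatrix g a b t l j := by
  rw [fiberMatrix_eq, fiberMatrix_eq, map_mul, Complex.conj_ofReal, Complex.conj_tsum]
  congr 2
  funext n
  rw [map_mul, Complex.conj_conj, mul_comm]

theorem fiberMatrix_add (g : L2R) (a b t : ℝ) (i j : ℤ) :
    fiberMatrix g a b (t + i / b) 0 j = fiberMatrix g a b t i (i + j) := by
  unfold fiberMatrix
  congr 2
  · ring
  · simp

/-! #### Decomposition of the line into cells -/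

theorem cell_preimage (b x : ℝ) (j : ℤ) :
    (fun t => t - j / b) ⁻¹' Set.Ioc x (x + 1 / b) =
      Set.Ioc (x + j • (1 / b)) (x + (j + 1) • (1 / b)) := by
  ext t
  simp only [Set.mem_preimage, Set.mem_Ioc, zsmul_eq_mul]
  push_cast
  constructor <;> rintro ⟨h1, h2⟩ <;> constructor <;> ring_nf at * <;> linarith

theorem iUnion_cell {b : ℝ} (hb : 0 < b) (x : ℝ) :
    ⋃ j : ℤ, (fun t => t - j / b) ⁻¹' Set.Ioc x (x + 1 / b) = Set.univ := by
  simp only [cell_preimage]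
  exact iUnion_Ioc_add_zsmul (by positivity) x

theorem pairwise_disjoint_cell (b x : ℝ) :
    Pairwise (Function.onFun Disjoint
      fun j : ℤ => (fun t : ℝ => t - j / b) ⁻¹' Set.Ioc x (x + 1 / b)) := by
  simp only [cell_preimage]
  exact Set.pairwise_disjoint_Ioc_add_zsmul x (1 / b)

theorem notMem_cell_of_ne {b x t : ℝ} {i j : ℤ} (hij : i ≠ j)
    (h : t - i / b ∈ Set.Ioc x (x + 1 / b)) : t - j / b ∉ Set.Ioc x (x + 1 / b) :=
  Set.disjoint_left.1 (pairwise_disjoint_cell b x hij) h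

theorem measurableSet_cell (b x : ℝ) (j : ℤ) :
    MeasurableSet ((fun t : ℝ => t - j / b) ⁻¹' Set.Ioc x (x + 1 / b)) :=
  measurableSet_Ioc.preimage (measurable_id.sub_const _)

theorem tsum_lintegral_cell {b : ℝ} (hb : 0 < b) (x : ℝ) (F : ℝ → ℝ≥0∞) :
    ∑' j : ℤ, ∫⁻ t in Set.Ioc x (x + 1 / b), F (t + j / b) = ∫⁻ t, F t := by
  rw [← setLIntegral_univ F, ← iUnion_cell hb x,
    lintegral_iUnion (measurableSet_cell b x) (pairwise_disjoint_cell b x)]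
  refine tsum_congr fun j => ?_
  rw [← (measurePreserving_add_right volume (j / b : ℝ)).setLIntegral_comp_preimage_emb
    (MeasurableEquiv.addRight (j / b : ℝ)).measurableEmbedding F
    ((fun t => t - j / b) ⁻¹' Set.Ioc x (x + 1 / b))]
  congr 2
  ext t
  simp

theorem hasSum_integral_cell {b : ℝ} (hb : 0 < b) (x : ℝ) {F : ℝ → ℂ} (hF : Integrable F) :
    HasSum (fun j : ℤ => ∫ t in Set.Ioc x (x + 1 / b), F (t + j / b)) (∫ t, F t) := by
  have h := hasSum_integral_iUnion (measurableSet_cell b x) (pairwise_disjoint_cell b x)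
    (hF.integrableOn (s := ⋃ j : ℤ, (fun t : ℝ => t - j / b) ⁻¹' Set.Ioc x (x + 1 / b)))
  rw [iUnion_cell hb x, setIntegral_univ] at h
  refine h.congr_fun fun j => ?_
  rw [← (measurePreserving_add_right volume (j / b : ℝ)).setIntegral_preimage_emb
    (MeasurableEquiv.addRight (j / b : ℝ)).measurableEmbedding F
    ((fun t => t - j / b) ⁻¹' Set.Ioc x (x + 1 / b))]
  congr 2
  ext t
  simp

theorem ae_of_forall_ae_restrict_cell {b : ℝ} (hb : 0 < b) {p : ℝ → Prop}
    (h : ∀ x, ∀ᵐ t ∂volume.restrict (Set.Ioc x (x + 1 / b)), p t) : ∀ᵐ t, p t := by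
  rw [← Measure.restrict_univ (μ := (volume : Measure ℝ)), ← iUnion_cell hb 0,
    ae_restrict_iUnion_iff]
  intro j
  have := h (0 + j • (1 / b))
  rwa [cell_preimage, add_smul, one_smul, ← add_assoc]

/-! #### Walnut's representation -/

theorem integrableOn_translate (f : L2R) (y x T : ℝ) :
    IntegrableOn (fun t => f (t + y)) (Set.Ioc x (x + T)) :=
  ((memLp_translate f y).restrict _).integrable (by norm_num)

/-- Both sides have the same integral over every measurable subset of the cell, by
`inner_shiftInd_frameOperator`. -/
theorem frameOperator_shiftInd_ae {a b : ℝ} (ha : 0 < a) (hb : 0 < b) {g : L2R}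
    (h : HasUpperFrameBound (whSystem g a b)) (x : ℝ) {E : Set ℝ}
    (hE : MeasurableSet E) (hE' : volume E ≠ ⊤) (hEJ : E ⊆ Set.Ioc x (x + 1 / b)) (j l : ℤ) :
    ∀ᵐ t ∂volume.restrict (Set.Ioc x (x + 1 / b)),
      frameOperator (whSystem g a b) (shiftInd hE hE' (l / b)) (t + j / b) =
        E.indicator (fun t => fiberMatrix g a b t j l) t := by
  refine Integrable.ae_eq_of_forall_setIntegral_eq _ _ (integrableOn_translate _ _ _ _)
    ((integrableOn_fiberMatrix ha b x (1 / b) g j l).indicator hE) fun s hs _ => ?_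
  have hD : MeasurableSet (s ∩ Set.Ioc x (x + 1 / b)) := hs.inter measurableSet_Ioc
  have hD' : volume (s ∩ Set.Ioc x (x + 1 / b)) ≠ ⊤ :=
    ne_top_of_le_ne_top (by simp) (measure_mono Set.inter_subset_right)
  rw [Measure.restrict_restrict hs, ← inner_shiftInd hD hD',
    inner_shiftInd_frameOperator ha hb h x hD hD' Set.inter_subset_right hE hE' hEJ,
    setIntegral_indicator hE]

/-- Integrals of Sf over D equal ⟨S 1_D, f⟩ by symmetry; the action on 1_D is already known, and
cutting the line into cells gives the series. -/
theorem frameOperator_ae_restrict {a b : ℝ} (ha : 0 < a) (hb : 0 < b) {g : L2R}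
    (h : HasUpperFrameBound (whSystem g a b)) (f : L2R) (x : ℝ) :
    ∀ᵐ t ∂volume.restrict (Set.Ioc x (x + 1 / b)),
      HasSum (fun j : ℤ => fiberMatrix g a b t 0 j * f (t + j / b))
        (frameOperator (whSystem g a b) f t) := by
  set J := Set.Ioc x (x + 1 / b) with hJdef
  have hJ : MeasurableSet J := measurableSet_Ioc
  have hJ' : volume J ≠ ⊤ := by simp [hJdef]
  set S := frameOperator (whSystem g a b) with hS
  set u : ℤ → ℝ → ℂ := fun j t => fiberMatrix g a b t 0 j * f (t + j / b) with hu
  have hker : ∀ {D : Set ℝ} (hD : MeasurableSet D) (hD' : volume D ≠ ⊤) (_ : D ⊆ J) (j : ℤ),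
      ∀ᵐ t ∂volume.restrict J,
        starRingEnd ℂ (S (shiftInd hD hD' (0 : ℤ)) (t + j / b)) * f (t + j / b) =
          D.indicator (u j) t := by
    intro D hD hD' hDJ j
    have h1 := frameOperator_shiftInd_ae ha hb h x hD hD' hDJ j 0
    simp only [Int.cast_zero, zero_div] at h1
    filter_upwards [h1] with t ht
    simp only [Int.cast_zero]
    rw [ht]
    by_cases hm : t ∈ D
    · simp only [hm, Set.indicator_of_mem, conj_fiberMatrix, hu]
    · simp [hm]
  have hint : ∀ v : L2R, Integrable (fun t => starRingEnd ℂ (v t) * f t) := fun v => by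
    simpa only [RCLike.inner_apply'] using L2.integrable_inner (𝕜 := ℂ) v f
  -- The terms reassemble the product of the two L² functions S 1_J (conjugated) and f. Absolute
  -- convergence thus needs no decay of the correlations.
  have hfin : ∑' j, ∫⁻ t in J, ‖u j t‖ₑ ≠ ⊤ := by
    have h2 : ∀ j, ∫⁻ t in J, ‖u j t‖ₑ = ∫⁻ t in J,
        ‖starRingEnd ℂ (S (shiftInd hJ hJ' (0 : ℤ)) (t + j / b)) * f (t + j / b)‖ₑ := by
      intro j
      refine lintegral_congr_ae ?_
      filter_upwards [hker hJ hJ' subset_rfl j, ae_restrict_mem hJ] with t ht htJ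
      rw [ht, Set.indicator_of_mem htJ]
    simp only [h2]
    rw [tsum_lintegral_cell hb x
      (fun t => ‖starRingEnd ℂ (S (shiftInd hJ hJ' (0 : ℤ)) t) * f t‖ₑ)]
    exact (hint _).2.ne
  have hmeas : ∀ j, AEStronglyMeasurable (u j) (volume.restrict J) := by
    intro j
    have h3 := (integrableOn_fiberMatrix ha b x (1 / b) g 0 j).1
    exact h3.mul (aestronglyMeasurable_translate f _).restrict
  obtain ⟨hsum, hi, -⟩ := ae_summable_and_integrable_tsum hmeas hfin
  have heq : ∀ᵐ t ∂volume.restrict J, S f t = ∑' j, u j t := by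
    have h0 := integrableOn_translate (S f) 0 x (1 / b)
    simp only [add_zero] at h0
    refine Integrable.ae_eq_of_forall_setIntegral_eq _ _ h0 hi fun s hs _ => ?_
    have hD : MeasurableSet (s ∩ J) := hs.inter hJ
    have hD' : volume (s ∩ J) ≠ ⊤ := ne_top_of_le_ne_top hJ' (measure_mono Set.inter_subset_right)
    rw [Measure.restrict_restrict hs]
    have h4 : ∫ t in s ∩ J, S f t = inner ℂ (S (shiftInd hD hD' (0 : ℤ))) f := by
      rw [hS, h.inner_frameOperator_comm, inner_shiftInd]
      simp
    have h5 : HasSum (fun j => ∫ t in s ∩ J, u j t)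
        (inner ℂ (S (shiftInd hD hD' (0 : ℤ))) f) := by
      rw [L2.inner_def]
      simp only [RCLike.inner_apply']
      refine (hasSum_integral_cell hb x (hint (S (shiftInd hD hD' (0 : ℤ))))).congr_fun fun j => ?_
      rw [integral_congr_ae (hker hD hD' Set.inter_subset_right j), setIntegral_indicator hD]
      congr 2
      ext t
      simp
    have h6 := (ae_summable_and_integrable_tsum (μ := volume.restrict (s ∩ J)) (F := u)
      (fun j => (hmeas j).mono_measure (Measure.restrict_mono Set.inter_subset_right le_rfl))
      (ne_top_of_le_ne_top hfin
        (ENNReal.tsum_le_tsum fun j => lintegral_mono_set Set.inter_subset_right))).2.2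
    rw [h4]
    exact h5.unique h6
  filter_upwards [hsum, heq] with t h1 h2
  rw [h2]
  exact h1.hasSum

/-- Walnut's representation of the frame operator, on almost every fibre. -/
theorem frameOperator_ae {a b : ℝ} (ha : 0 < a) (hb : 0 < b) {g : L2R}
    (h : HasUpperFrameBound (whSystem g a b)) (f : L2R) :
    ∀ᵐ t, ∀ i : ℤ, HasSum (fun l : ℤ => fiberMatrix g a b t i l * f (t + l / b))
      (frameOperator (whSystem g a b) f (t + i / b)) := by
  rw [ae_all_iff]
  intro i
  have h1 := ae_of_forall_ae_restrict_cell hb (frameOperator_ae_restrict ha hb h f)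
  filter_upwards [ae_comp_add h1 (i / b)] with t ht
  rw [← (Equiv.addLeft i).hasSum_iff]
  refine ht.congr_fun fun j => ?_
  simp only [Function.comp_apply, Equiv.coe_addLeft]
  rw [fiberMatrix_add]
  congr 2
  push_cast
  ring_nf

end Walnut

/-! ### Quadratic forms of the fibre matrices -/

section Forms

theorem norm_sq_sum_shiftInd {b : ℝ} (x : ℝ) {D : Set ℝ} (hD : MeasurableSet D)
    (hD' : volume D ≠ ⊤) (hDJ : D ⊆ Set.Ioc x (x + 1 / b)) (s : Finset ℤ) (c : ℤ → ℂ) :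
    ‖∑ j ∈ s, c j • shiftInd hD hD' (j / b)‖ ^ 2 = (∑ j ∈ s, ‖c j‖ ^ 2) * volume.real D := by
  have h1 : ∀ j l : ℤ, inner ℂ (shiftInd hD hD' (j / b)) (shiftInd hD hD' (l / b)) =
      if j = l then (volume.real D : ℂ) else 0 := by
    intro j l
    rw [inner_shiftInd]
    have h2 : ∀ᵐ t, t ∈ D → shiftInd hD hD' (l / b) (t + j / b) = if j = l then 1 else 0 := by
      filter_upwards [ae_comp_add (coeFn_shiftInd hD hD' (l / b)) (j / b - l / b)] with t ht htD
      rw [show t + (j / b - l / b) + l / b = t + j / b by ring] at ht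
      rw [ht]
      split_ifs with hjl
      · simp [hjl, htD]
      · refine Set.indicator_of_notMem (fun hm => hjl ?_) _
        have e1 := hDJ htD
        have e2 := hDJ hm
        by_contra hne
        refine notMem_cell_of_ne (t := t + (j / b - l / b)) (sub_ne_zero.2 hne) ?_ (j := 0)
          (by simpa using e2)
        convert e1 using 1
        push_cast
        ring
    rw [setIntegral_congr_ae hD h2, setIntegral_const]
    split_ifs <;> simp
  have h3 : ((‖∑ j ∈ s, c j • shiftInd hD hD' (j / b)‖ ^ 2 : ℝ) : ℂ) =
      (((∑ j ∈ s, ‖c j‖ ^ 2) * volume.real D : ℝ) : ℂ) := by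
    rw [Complex.ofReal_pow]
    refine Eq.trans (inner_self_eq_norm_sq_to_K (𝕜 := ℂ)
      (∑ j ∈ s, c j • shiftInd hD hD' (j / b))).symm ?_
    rw [sum_inner]
    simp only [inner_sum, inner_smul_left, inner_smul_right, h1]
    rw [Complex.ofReal_mul, Complex.ofReal_sum, Finset.sum_mul]
    refine Finset.sum_congr rfl fun j hj => ?_
    rw [Finset.sum_eq_single_of_mem j hj fun l _ hl => by simp [hl.symm]]
    rw [if_pos rfl, ← mul_assoc, Complex.mul_conj', Complex.ofReal_pow]
  exact_mod_cast h3

theorem inner_sum_shiftInd_frameOperator {a b : ℝ} (ha : 0 < a) (hb : 0 < b) {g : L2R}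
    (h : HasUpperFrameBound (whSystem g a b)) (x : ℝ) {D : Set ℝ} (hD : MeasurableSet D)
    (hD' : volume D ≠ ⊤) (hDJ : D ⊆ Set.Ioc x (x + 1 / b)) (s : Finset ℤ) (c : ℤ → ℂ) :
    (inner ℂ (∑ j ∈ s, c j • shiftInd hD hD' (j / b)) (frameOperator (whSystem g a b)
      (∑ j ∈ s, c j • shiftInd hD hD' (j / b)))).re =
      ∫ t in D, (∑ j ∈ s, ∑ l ∈ s, starRingEnd ℂ (c j) * fiberMatrix g a b t j l * c l).re := by
  obtain ⟨S, hS⟩ := h.exists_clm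
  have hSe : ∀ u, frameOperator (whSystem g a b) u = S u := fun u => (hS u).tsum_eq
  have hi : ∀ j l : ℤ, Integrable (fun t => starRingEnd ℂ (c j) * fiberMatrix g a b t j l * c l)
      (volume.restrict D) := fun j l =>
    (((integrableOn_fiberMatrix ha b x (1 / b) g j l).mono_set hDJ).const_mul _).mul_const _
  have h1 := integral_re (𝕜 := ℂ) (μ := volume.restrict D)
    (integrable_finsetSum s fun j _ => integrable_finsetSum s fun l _ => hi j l)
  simp only [RCLike.re_eq_complex_re] at h1
  rw [h1]
  congr 1
  rw [integral_finsetSum s fun j _ => integrable_finsetSum s fun l _ => hi j l,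
    hSe, sum_inner]
  refine Finset.sum_congr rfl fun j _ => ?_
  rw [integral_finsetSum s fun l _ => hi j l, map_sum, inner_sum]
  refine Finset.sum_congr rfl fun l _ => ?_
  rw [map_smul, inner_smul_left, inner_smul_right, ← hSe,
    inner_shiftInd_frameOperator ha hb h x hD hD' hDJ hD hD' hDJ, Set.inter_self,
    integral_mul_const, integral_const_mul]
  ring

/-- Testing the operator inequality on ∑ c j 1_{D + j/b} gives the integrated inequality over every
measurable D in a cell, hence the pointwise one. -/
theorem ae_le_form {a b : ℝ} (ha : 0 < a) (hb : 0 < b) {g : L2R}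
    (h : HasUpperFrameBound (whSystem g a b)) {A : ℝ}
    (hA : ∀ f, A * ‖f‖ ^ 2 ≤ (inner ℂ f (frameOperator (whSystem g a b) f)).re)
    (s : Finset ℤ) (c : ℤ → ℂ) :
    ∀ᵐ t, A * ∑ j ∈ s, ‖c j‖ ^ 2 ≤
      (∑ j ∈ s, ∑ l ∈ s, starRingEnd ℂ (c j) * fiberMatrix g a b t j l * c l).re := by
  refine ae_of_forall_ae_restrict_cell hb fun x => ?_
  have hi : Integrable (fun t =>
      (∑ j ∈ s, ∑ l ∈ s, starRingEnd ℂ (c j) * fiberMatrix g a b t j l * c l).re)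
      (volume.restrict (Set.Ioc x (x + 1 / b))) :=
    (integrable_finsetSum s fun j _ => integrable_finsetSum s fun l _ =>
      ((integrableOn_fiberMatrix ha b x (1 / b) g j l).const_mul _).mul_const _).re
  refine ae_le_of_forall_setIntegral_le (integrable_const _) hi fun D₀ hD₀ _ => ?_
  have hD : MeasurableSet (D₀ ∩ Set.Ioc x (x + 1 / b)) := hD₀.inter measurableSet_Ioc
  have hD' : volume (D₀ ∩ Set.Ioc x (x + 1 / b)) ≠ ⊤ :=
    ne_top_of_le_ne_top (by simp) (measure_mono Set.inter_subset_right)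
  rw [Measure.restrict_restrict hD₀, setIntegral_const, smul_eq_mul,
    ← inner_sum_shiftInd_frameOperator ha hb h x hD hD' Set.inter_subset_right]
  refine le_of_eq_of_le ?_ (hA _)
  rw [norm_sq_sum_shiftInd x hD hD' Set.inter_subset_right]
  ring

theorem ae_form_le {a b : ℝ} (ha : 0 < a) (hb : 0 < b) {g : L2R}
    (h : HasUpperFrameBound (whSystem g a b)) {B : ℝ}
    (hB : ∀ f, (inner ℂ f (frameOperator (whSystem g a b) f)).re ≤ B * ‖f‖ ^ 2)
    (s : Finset ℤ) (c : ℤ → ℂ) :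
    ∀ᵐ t, (∑ j ∈ s, ∑ l ∈ s, starRingEnd ℂ (c j) * fiberMatrix g a b t j l * c l).re ≤
      B * ∑ j ∈ s, ‖c j‖ ^ 2 := by
  refine ae_of_forall_ae_restrict_cell hb fun x => ?_
  have hi : Integrable (fun t =>
      (∑ j ∈ s, ∑ l ∈ s, starRingEnd ℂ (c j) * fiberMatrix g a b t j l * c l).re)
      (volume.restrict (Set.Ioc x (x + 1 / b))) :=
    (integrable_finsetSum s fun j _ => integrable_finsetSum s fun l _ =>
      ((integrableOn_fiberMatrix ha b x (1 / b) g j l).const_mul _).mul_const _).re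
  refine ae_le_of_forall_setIntegral_le hi (integrable_const _) fun D₀ hD₀ _ => ?_
  have hD : MeasurableSet (D₀ ∩ Set.Ioc x (x + 1 / b)) := hD₀.inter measurableSet_Ioc
  have hD' : volume (D₀ ∩ Set.Ioc x (x + 1 / b)) ≠ ⊤ :=
    ne_top_of_le_ne_top (by simp) (measure_mono Set.inter_subset_right)
  rw [Measure.restrict_restrict hD₀, setIntegral_const, smul_eq_mul,
    ← inner_sum_shiftInd_frameOperator ha hb h x hD hD' Set.inter_subset_right]
  refine (hB _).trans_eq ?_
  rw [norm_sq_sum_shiftInd x hD hD' Set.inter_subset_right]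
  ring

/-- Almost every fibre matrix is coercive, with the lower frame bound as a constant. -/
theorem ae_forall_le_form {a b : ℝ} (ha : 0 < a) (hb : 0 < b) {g : L2R}
    (h : HasUpperFrameBound (whSystem g a b)) {A : ℝ}
    (hA : ∀ f, A * ‖f‖ ^ 2 ≤ (inner ℂ f (frameOperator (whSystem g a b) f)).re) :
    ∀ᵐ t, ∀ (s : Finset ℤ) (c : ℤ → ℂ), A * ∑ j ∈ s, ‖c j‖ ^ 2 ≤
      (∑ j ∈ s, ∑ l ∈ s, starRingEnd ℂ (c j) * fiberMatrix g a b t j l * c l).re := by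
  -- One null set must serve all c. For fixed finite s the inequality is closed in the product
  -- topology, so a countable dense family is enough.
  obtain ⟨d, hd⟩ := TopologicalSpace.exists_dense_seq (ℤ → ℂ)
  have h1 : ∀ᵐ t, ∀ (s : Finset ℤ) (n : ℕ), A * ∑ j ∈ s, ‖d n j‖ ^ 2 ≤
      (∑ j ∈ s, ∑ l ∈ s, starRingEnd ℂ (d n j) * fiberMatrix g a b t j l * d n l).re := by
    rw [ae_all_iff]
    intro s
    rw [ae_all_iff]
    intro n
    exact ae_le_form ha hb h hA s (d n)
  filter_upwards [h1] with t ht s c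
  refine hd.induction_on (p := fun c : ℤ → ℂ => A * ∑ j ∈ s, ‖c j‖ ^ 2 ≤
      (∑ j ∈ s, ∑ l ∈ s, starRingEnd ℂ (c j) * fiberMatrix g a b t j l * c l).re) c ?_ (ht s)
  refine isClosed_le (by fun_prop) (Complex.continuous_re.comp ?_)
  refine continuous_finsetSum _ fun j _ => continuous_finsetSum _ fun l _ => ?_
  exact ((Complex.continuous_conj.comp (continuous_apply j)).mul continuous_const).mul
    (continuous_apply l)

/-- The correlation functions of a Weyl–Heisenberg system with a finite upper frame bound are
uniformly essentially bounded. -/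
theorem exists_ae_enorm_corr_le {a b : ℝ} (ha : 0 < a) (hb : 0 < b) {g : L2R}
    (h : HasUpperFrameBound (whSystem g a b)) :
    ∃ C : ℝ≥0∞, C ≠ ⊤ ∧ ∀ᵐ t, ∀ k, ‖corr g a b k t‖ₑ ≤ C := by
  obtain ⟨B, hB, hfB⟩ := id h
  -- The diagonal entry alone gives ∑ |g(t - na)|² ≤ bB; Cauchy–Schwarz then bounds every
  -- correlation.
  have hform := ae_form_le ha hb h (B := B)
    (fun f => (h.re_inner_frameOperator f).trans_le (hfB f).2) {0} 1
  have hsum : ∀ᵐ t, Summable fun n : ℤ =>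
      g (t + 0 - n * a) * starRingEnd ℂ (g (t + 0 - n * a)) :=
    ae_of_forall_ae_restrict_cell hb fun x =>
      (correlation_properties ha x (1 / b) 0 0 g subset_rfl).1
  have hQ : ∀ᵐ t, ∑' n : ℤ, ‖g (t - n * a)‖ₑ ^ 2 ≤ ENNReal.ofReal (b * B) := by
    filter_upwards [hform, hsum] with t h1 h2
    simp only [add_zero, Complex.mul_conj'] at h2
    have h2' : Summable fun n : ℤ => ‖g (t - n * a)‖ ^ 2 := by exact_mod_cast h2
    have h3 : b⁻¹ * ∑' n : ℤ, ‖g (t - n * a)‖ ^ 2 ≤ B := by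
      simp only [Finset.sum_singleton, Pi.one_apply, map_one, one_mul, mul_one, norm_one, one_pow,
        fiberMatrix_eq, Int.cast_zero, zero_div, add_zero, Complex.mul_conj', one_div] at h1
      exact_mod_cast h1
    have h4 : ∀ n : ℤ, ‖g (t - n * a)‖ₑ ^ 2 = ENNReal.ofReal (‖g (t - n * a)‖ ^ 2) := fun n => by
      rw [ENNReal.ofReal_pow (norm_nonneg _), ofReal_norm]
    simp only [h4]
    rw [← ENNReal.ofReal_tsum_of_nonneg (fun _ => by positivity) h2']
    refine ENNReal.ofReal_le_ofReal ?_
    rwa [inv_mul_le_iff₀ hb] at h3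
  refine ⟨ENNReal.ofReal (b * B), ENNReal.ofReal_ne_top, ?_⟩
  have hQ' : ∀ᵐ t, ∀ k : ℤ, ∑' n : ℤ, ‖g (t - k / b - n * a)‖ₑ ^ 2 ≤ ENNReal.ofReal (b * B) :=
    ae_all_iff.2 fun k => ae_comp_sub hQ (k / b)
  filter_upwards [hQ, hQ'] with t h1 h2 k
  calc ‖corr g a b k t‖ₑ ≤ ∑' n : ℤ, ‖g (t - n * a)‖ₑ * ‖g (t - k / b - n * a)‖ₑ := by
        refine enorm_tsum_le_tsum_enorm.trans_eq (tsum_congr fun n => ?_)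
        rw [enorm_mul, RCLike.enorm_conj, sub_right_comm]
    _ ≤ ENNReal.ofReal (b * B) ^ (1 / 2 : ℝ) * ENNReal.ofReal (b * B) ^ (1 / 2 : ℝ) := by
        refine (tsum_mul_le_sqrt_mul_sqrt _ _).trans ?_
        gcongr
        exact h2 k
    _ = ENNReal.ofReal (b * B) := by
        rw [← ENNReal.rpow_add_of_nonneg _ _ (by norm_num) (by norm_num)]
        norm_num

end Forms

/-! ### Rational periodicity and the dual window -/

section Main

theorem tail_eq_tsum_subtype (a : ℤ → ℝ≥0∞) (K : ℕ) :
    tail a K = ∑' k : {k : ℤ // (K : ℤ) ≤ |k|}, a k := by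
  rw [tail]
  refine Eq.trans (tsum_congr fun k => ?_) (tsum_subtype {k : ℤ | (K : ℤ) ≤ |k|} a).symm
  simp [Set.indicator_apply]

theorem tail_neg (a : ℤ → ℝ≥0∞) (K : ℕ) : tail (fun k => a (-k)) K = tail a K := by
  unfold tail
  rw [← (Equiv.neg ℤ).tsum_eq fun k => if (K : ℤ) ≤ |k| then a k else 0]
  simp

theorem tail_const_mul (c : ℝ≥0∞) (a : ℤ → ℝ≥0∞) (K : ℕ) :
    tail (fun k => c * a k) K = c * tail a K := by
  unfold tail
  rw [← ENNReal.tsum_mul_left]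
  exact tsum_congr fun k => by split_ifs <;> simp

theorem tail_sum {ι : Type*} (s : Finset ι) (a : ι → ℤ → ℝ≥0∞) (K : ℕ) :
    tail (fun k => ∑ i ∈ s, a i k) K = ∑ i ∈ s, tail (a i) K := by
  unfold tail
  rw [← Summable.tsum_finsetSum fun _ _ => ENNReal.summable]
  exact tsum_congr fun k => by split_ifs <;> simp

theorem tsum_le_add_tail {a : ℤ → ℝ≥0∞} {C : ℝ≥0∞} (hC : ∀ k, a k ≤ C) (K : ℕ) :
    ∑' k, a k ≤ (2 * K + 1 : ℕ) * C + tail a K := by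
  have h1 : ∀ k, a k = (if (K : ℤ) ≤ |k| then 0 else a k) + if (K : ℤ) ≤ |k| then a k else 0 :=
    fun k => by split_ifs <;> simp
  rw [tsum_congr h1, ENNReal.tsum_add, tail]
  gcongr
  rw [tsum_eq_sum (s := Finset.Icc (-(K : ℤ)) K) fun k hk => ?_]
  · refine (Finset.sum_le_card_nsmul _ _ C fun k _ => ?_).trans ?_
    · split_ifs
      · exact zero_le
      · exact hC k
    · rw [nsmul_eq_mul, Int.card_Icc]
      gcongr
      omega
  · refine if_pos ?_
    by_contra! h
    have := abs_lt.1 h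
    exact hk (Finset.mem_Icc.2 ⟨by omega, by omega⟩)

theorem corr_add_int_mul (g : L2R) (a b : ℝ) (k n : ℤ) (t : ℝ) :
    corr g a b k (t + n * a) = corr g a b k t := by
  unfold corr
  rw [← (Equiv.addRight n).tsum_eq]
  refine tsum_congr fun m => ?_
  simp only [Equiv.coe_addRight]
  push_cast
  rw [show t + n * a - (m + n) * a = t - m * a by ring]

/-- Here p/b = qa is a multiple of the period a, so only j modulo p matters. -/
theorem corr_add_div_of_rational {a b : ℝ} (hb : 0 < b) {p : ℕ} {q : ℤ} (hpq : (p : ℝ) = q * (a * b))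
    (g : L2R) (k j : ℤ) (t : ℝ) :
    corr g a b k (t + j / b) = corr g a b k (t + (j % p : ℤ) / b) := by
  have h : t + j / b = t + (j % p : ℤ) / b + ((j / p * q : ℤ) : ℝ) * a := by
    have h1 : (j : ℝ) = p * (j / (p : ℤ) : ℤ) + (j % (p : ℤ) : ℤ) := by
      exact_mod_cast (Int.mul_ediv_add_emod j p).symm
    push_cast
    field_simp
    rw [h1, hpq]
    ring
  rw [h, corr_add_int_mul]

theorem exists_rational_period {a b : ℝ} (ha : 0 < a) (hb : 0 < b)
    (hab : ∃ r : ℚ, (r : ℝ) = a * b) : ∃ (p : ℕ) (q : ℤ), 0 < p ∧ (p : ℝ) = q * (a * b) := by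
  obtain ⟨r, hr⟩ := hab
  have hr0 : 0 < r := by
    have : (0 : ℝ) < r := by rw [hr]; positivity
    exact_mod_cast this
  have hnum : 0 < r.num := Rat.num_pos.2 hr0
  refine ⟨r.num.toNat, r.den, by omega, ?_⟩
  rw [← hr]
  have h1 : ((r.num.toNat : ℤ) : ℝ) = r.num := by rw [Int.toNat_of_nonneg hnum.le]
  have h2 : (r.den : ℚ) * r = r.num := by rw [mul_comm]; exact Rat.mul_den_eq_num r
  have h3 : ((r.den : ℚ) * r : ℝ) = (r.num : ℝ) := by exact_mod_cast h2
  push_cast at h1 h3 ⊢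
  rw [h1, h3]

/-- The matrix of `S⁻¹` on almost every fibre has its first column given by the correlation
functions of the dual window, and it is inverse to the matrix of `S`. -/
theorem ae_hasSum_fiberMatrix_dual {a b : ℝ} (ha : 0 < a) (hb : 0 < b) {g : L2R}
    (hg : IsFrame (whSystem g a b)) :
    ∀ᵐ t, ∀ j : ℤ, HasSum (fun l : ℤ => fiberMatrix g a b t j l *
      fiberMatrix (hg.frameEquiv.symm g) a b t l 0) (if j = 0 then 1 else 0) := by
  refine ae_of_forall_ae_restrict_cell hb fun x => ?_
  have hup : HasUpperFrameBound (whSystem (hg.frameEquiv.symm g) a b) := by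
    rw [whSystem_dual hg]
    exact hg.hasUpperFrameBound_dual
  have hJ : MeasurableSet (Set.Ioc x (x + 1 / b)) := measurableSet_Ioc
  have hJ' : volume (Set.Ioc x (x + 1 / b)) ≠ ⊤ := by simp
  -- With f = S⁻¹ 1_J, the values of f on a fibre are column 0 of the dual matrix, because S⁻¹ is
  -- the dual frame operator; applying S returns 1_J, which is δ₀ on the fibre.
  set f := hg.frameEquiv.symm (shiftInd hJ hJ' ((0 : ℤ) / b)) with hf
  have h1 := ae_restrict_of_ae (s := Set.Ioc x (x + 1 / b))
    (frameOperator_ae ha hb hg.hasUpperFrameBound f)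
  have h2 : ∀ᵐ t ∂volume.restrict (Set.Ioc x (x + 1 / b)), ∀ l : ℤ,
      f (t + l / b) = fiberMatrix (hg.frameEquiv.symm g) a b t l 0 := by
    rw [ae_all_iff]
    intro l
    filter_upwards [frameOperator_shiftInd_ae ha hb hup x hJ hJ' subset_rfl l 0,
      ae_restrict_mem hJ] with t ht htJ
    rw [Set.indicator_of_mem htJ, whSystem_dual hg, hg.frameOperator_dual] at ht
    exact ht
  have h3 : ∀ᵐ t ∂volume.restrict (Set.Ioc x (x + 1 / b)), ∀ j : ℤ,
      shiftInd hJ hJ' ((0 : ℤ) / b) (t + j / b) = if j = 0 then 1 else 0 := by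
    rw [ae_all_iff]
    intro j
    filter_upwards [ae_restrict_of_ae (ae_comp_add (coeFn_shiftInd hJ hJ' ((0 : ℤ) / b)) (j / b)),
      ae_restrict_mem hJ] with t ht htJ
    simp only [Int.cast_zero, zero_div, add_zero] at ht ⊢
    rw [ht]
    split_ifs with hj
    · refine Set.indicator_of_mem ?_ _
      simpa [hj] using htJ
    · refine Set.indicator_of_notMem (fun hm => ?_) _
      exact notMem_cell_of_ne (b := b) (x := x) (t := t + j / b) (j := 0) hj
        (by rwa [add_sub_cancel_right]) (by simpa using hm)
  filter_upwards [h1, h2, h3] with t h1 h2 h3 j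
  have h4 := h1 j
  rw [hf, hg.frameOperator_symm, h3 j] at h4
  simpa only [← hf, h2] using h4

theorem uniformCC_dual {a b : ℝ} (ha : 0 < a) (hb : 0 < b) (hab : ∃ r : ℚ, (r : ℝ) = a * b)
    {g : L2R} (hg : IsFrame (whSystem g a b)) (hcc : UniformCC g a b) :
    UniformCC (hg.frameEquiv.symm g) a b := by
  set γ := hg.frameEquiv.symm g with hγ
  have hup : HasUpperFrameBound (whSystem γ a b) := by
    rw [whSystem_dual hg]
    exact hg.hasUpperFrameBound_dual
  refine ⟨hup, fun ε hε => ?_⟩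
  obtain ⟨p, q, hp, hpq⟩ := exists_rational_period ha hb hab
  obtain ⟨A, B, hA, -, hAB⟩ := id hg
  have hlow : ∀ f, A * ‖f‖ ^ 2 ≤ (inner ℂ f (frameOperator (whSystem g a b) f)).re := fun f => by
    rw [hg.hasUpperFrameBound.re_inner_frameOperator]
    exact (hAB f).2.1
  obtain ⟨C, hC, hgC⟩ := exists_ae_enorm_corr_le ha hb hg.hasUpperFrameBound
  obtain ⟨C', hC', hγC⟩ := exists_ae_enorm_corr_le ha hb hup
  -- Countably many tolerances keep the union of exceptional sets null.
  choose K hK0 hK using fun N : ℕ => hcc.2 (1 / (N + 1)) (by positivity)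
  have htail : ∀ᵐ t, ∀ N : ℕ,
      tail (fun k => ‖corr g a b k t‖ₑ) (K N) ≤ ENNReal.ofReal (1 / (N + 1)) := by
    rw [ae_all_iff]
    intro N
    filter_upwards [hK N] with t ht
    rw [tail_eq_tsum_subtype]
    exact ht.le
  set good : ℝ → Prop := fun t =>
    (∀ i k : ℤ, ‖corr g a b k (t + i / b)‖ₑ ≤ C) ∧
    (∀ (i : ℤ) (N : ℕ), tail (fun k => ‖corr g a b k (t + i / b)‖ₑ) (K N) ≤
      ENNReal.ofReal (1 / (N + 1))) ∧
    (∀ i k : ℤ, ‖corr γ a b k (t + i / b)‖ₑ ≤ C') ∧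
    (∀ (s : Finset ℤ) (c : ℤ → ℂ), A * ∑ j ∈ s, ‖c j‖ ^ 2 ≤
      (∑ j ∈ s, ∑ l ∈ s, starRingEnd ℂ (c j) * fiberMatrix g a b t j l * c l).re) ∧
    (∀ j : ℤ, HasSum (fun l : ℤ => fiberMatrix g a b t j l * fiberMatrix γ a b t l 0)
      (if j = 0 then 1 else 0)) with hgood
  have hae : ∀ᵐ t, good t := by
    filter_upwards [ae_all_iff.2 fun i : ℤ => ae_comp_add hgC (i / b),
      ae_all_iff.2 fun i : ℤ => ae_comp_add htail (i / b),
      ae_all_iff.2 fun i : ℤ => ae_comp_add hγC (i / b),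
      ae_forall_le_form ha hb hg.hasUpperFrameBound hlow,
      ae_hasSum_fiberMatrix_dual ha hb hg] with t h1 h2 h3 h4 h5
    exact ⟨h1, h2, h3, h4, h5⟩
  set β : ℝ≥0∞ := ‖((1 / b : ℝ) : ℂ)‖ₑ with hβ
  have hβt : β ≠ ⊤ := enorm_ne_top
  -- The matrix entry depends on the row j as well as on j - l; summing over the p residues of j
  -- gives a majorant in j - l alone.
  set m : {t // good t} → ℤ → ℝ≥0∞ := fun t k =>
    ∑ i ∈ Finset.range p, β * ‖corr g a b k (t + (i : ℤ) / b)‖ₑ with hm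
  have hmtail : ∀ (t : {t // good t}) (N : ℕ),
      tail (m t) (K N) ≤ p * (β * ENNReal.ofReal (1 / (N + 1))) := by
    intro t N
    rw [hm, tail_sum]
    refine (Finset.sum_le_card_nsmul _ _ (β * ENNReal.ofReal (1 / (N + 1))) fun i _ => ?_).trans ?_
    · rw [tail_const_mul]
      gcongr
      exact t.2.2.1 i N
    · rw [Finset.card_range, nsmul_eq_mul]
  have hmsum : UniformlySummable m := by
    refine ⟨⟨(2 * K 0 + 1 : ℕ) * (p * (β * C)) + p * (β * ENNReal.ofReal (1 / ((0 : ℕ) + 1))),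
      ?_, fun t => ?_⟩, fun δ hδ => ?_⟩
    · finiteness
    · refine (tsum_le_add_tail (C := p * (β * C)) (fun k => ?_) (K 0)).trans
        (add_le_add le_rfl (hmtail t 0))
      refine (Finset.sum_le_card_nsmul _ _ (β * C) fun i _ => ?_).trans ?_
      · gcongr
        exact t.2.1 i k
      · rw [Finset.card_range, nsmul_eq_mul]
    · obtain ⟨η, hη, hηδ⟩ := exists_ne_zero_mul_le (c := p * β) (by finiteness) hδ
      have hlim : Filter.Tendsto (fun N : ℕ => ENNReal.ofReal (1 / ((N : ℝ) + 1))) Filter.atTop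
          (nhds 0) := by
        simpa using ENNReal.tendsto_ofReal tendsto_one_div_add_atTop_nhds_zero_nat
      obtain ⟨N, hN⟩ := (hlim.eventually_le_const (pos_iff_ne_zero.2 hη)).exists
      refine ⟨K N, fun t => (hmtail t N).trans ?_⟩
      rw [← mul_assoc]
      exact (mul_le_mul_right hN _).trans hηδ
  obtain ⟨δ, hδ, hδε⟩ := exists_ne_zero_mul_le (c := ENNReal.ofReal b)
    (δ := ENNReal.ofReal (ε / 2)) ENNReal.ofReal_ne_top (by simpa using hε)
  obtain ⟨K', hK'⟩ := exists_tail_enorm_le (M := fun t : {t // good t} => fiberMatrix g a b t)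
    (a := m) (F := fun t l => fiberMatrix γ a b t l 0) hA hmsum
    (fun t j l => by
      have hpos : (0 : ℤ) < p := by exact_mod_cast hp
      have h0 := Int.emod_nonneg j hpos.ne'
      have h1 := Int.emod_lt_of_pos j hpos
      rw [fiberMatrix, corr_add_div_of_rational hb hpq, enorm_mul, hm]
      refine le_trans ?_ (Finset.single_le_sum (fun _ _ => zero_le)
        (Finset.mem_range.2 (show (j % p : ℤ).toNat < p by omega)))
      rw [Int.toNat_of_nonneg h0])
    (fun t => t.2.2.2.2.1)
    (fun t => ⟨β * C', by finiteness, fun l => by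
      rw [fiberMatrix, enorm_mul]
      gcongr
      exact t.2.2.2.1 _ _⟩)
    (fun t => t.2.2.2.2.2) hδ
  refine ⟨K' + 1, by omega, ?_⟩
  filter_upwards [hae] with t ht
  -- The correlations at t form row 0 of the dual matrix, whereas the Wiener lemma controls column
  -- 0; Hermitian symmetry exchanges them.
  have hcorr : ∀ k, ‖corr γ a b k t‖ₑ = ENNReal.ofReal b * ‖fiberMatrix γ a b t (-k) 0‖ₑ := by
    intro k
    rw [← conj_fiberMatrix, RCLike.enorm_conj, fiberMatrix]
    have h1 : ENNReal.ofReal b = ‖(b : ℂ)‖ₑ := by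
      rw [← ofReal_norm, Complex.norm_real, Real.norm_of_nonneg hb.le]
    have hb' : (b : ℂ) ≠ 0 := by exact_mod_cast hb.ne'
    rw [h1, ← enorm_mul]
    congr 1
    simp [hb']
  rw [← tail_eq_tsum_subtype (fun k => ‖corr γ a b k t‖ₑ)]
  simp only [hcorr]
  rw [tail_const_mul, tail_neg (fun k => ‖fiberMatrix γ a b t k 0‖ₑ)]
  calc ENNReal.ofReal b * tail (fun k => ‖fiberMatrix γ a b t k 0‖ₑ) (K' + 1)
      ≤ ENNReal.ofReal b * δ := by
        gcongr
        exact (tail_anti _ (Nat.le_succ K')).trans (hK' ⟨t, ht⟩)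
    _ ≤ ENNReal.ofReal (ε / 2) := hδε
    _ < ENNReal.ofReal ε := (ENNReal.ofReal_lt_ofReal_iff hε).2 (by linarith)

end Main

end WeylHeisenberg

end

theorem theorem4p14 (a b : ℝ) (ha : 0 < a) (hb : 0 < b) (hab : ∃ r : ℚ, (r : ℝ) = a * b)
    (g : Lp ℂ 2 (volume : Measure ℝ)) (hg : WeylHeisenberg.IsFrame (WeylHeisenberg.whSystem g a b))
    (hcc : WeylHeisenberg.UniformCC g a b) :
    WeylHeisenberg.UniformCC (hg.frameEquiv.symm g) a b :=
  WeylHeisenberg.uniformCC_dual ha hb hab hg hcc
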